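/- A subshift is a closed set $X\subseteq \mathsf A^{\mathbb Z}$ with $S(X)=X$, where $\mathsf A$ is a finite alphabet and $S$ is the shift, $(Sx)(i)=x(i+1)$. It is minimal if the orbit of each of its points is dense in it. Two subshifts are conjugate if there is a homeomorphism between them that commutes with the shifts. For $n\in\mathbb N$, let $L_n(X)$ be the set of all words of length $n$ that occur in elements of $X$. Let $\boldsymbol S$ be the set of all subshifts with some finite alphabet $\mathsf A\subseteq\mathbb Z$, with the metric $$d(X,Y)=2^{-\inf\{n\in\mathbb N\colon L_n(X)\neq L_n(Y)\}}\qquad(2^{-\infty}=0),$$ and let $\boldsymbol M\subseteq\boldsymbol S$ be the subspace of all infinite minimal subshifts. A subset of a topological space is generic if it contains a dense $G_\delta$ subset. A directive sequence is a sequence $\boldsymbol\tau=(\tau_n\colon A_{n+1}^*\to A_n^*)_{n\ge 0}$ of monoid morphisms between the sets of finite words over finite nonempty alphabets $A_n$, such that no $\tau_n$ maps a letter to the empty word. For $n<N$ write $\tau_{[n,N)}=\tau_n\circ\cdots\circ\tau_{N-1}$, and let $X^{(n)}_{\boldsymbol\tau}$ be the set of all $x\in A_n^{\mathbb Z}$ such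 that each finite subword of $x$ occurs in $\tau_{[n,N)}(a)$ for some $N>n$ and $a\in A_N$. The subshift generated by $\boldsymbol\tau$ is $X_{\boldsymbol\tau}=X^{(0)}_{\boldsymbol\tau}$. The alphabet rank of $\boldsymbol\tau$ is $\liminf_n|A_n|$. The sequence $\boldsymbol\tau$ is - of constant length if for each $n$ the length of $\tau_n(a)$ does not depend on $a\in A_{n+1}$; - primitive if for each $n$ there is $N>n$ such that every letter of $A_n$ occurs in $\tau_{[n,N)}(a)$ for every $a\in A_N$; - proper if for each $n$ all words $\tau_n(a)$, $a\in A_{n+1}$, have the same first letter and the same last letter; - recognizable if for each $n$ every $x\in A_n^{\mathbb Z}$ has at most one representation $x=S^k\tau_n(y)$ with $y\in X^{(n+1)}_{\boldsymbol\tau}$ and $0\le k<|\tau_n(y(0))|$, where $\tau_n(y)=\cdots\tau_n(y(-1)).\tau_n(y(0))\tau_n(y(1))\cdots$, the dot marking position $0$. For an integer $K\ge 2$, a strong Toeplitz subshift of rank $K$ is a subshift that is conjugate to $X_{\boldsymbol\tau}$ for some constant-length, primitive, proper and recognizable directive sequence $\boldsymbol\tau$ of alphabet rank at most $K$. A strong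 Toeplitz subshift of finite rank is a strong Toeplitz subshift of rank $K$ for some $K\ge 2$. **Theorem.** The space $\boldsymbol M$ is Polish. The set of all $X\in\boldsymbol M$ that are strong Toeplitz subshifts of rank $2$ is generic in $\boldsymbol M$. Hence the set of all $X\in\boldsymbol M$ that are strong Toeplitz subshifts of finite rank is also generic in $\boldsymbol M$. -/

import Mathlib

open Filter Topology

namespace StrongToeplitz

/-! ### Bi-infinite words -/

/-- The `k`-th power of the shift: `(S ^ k x) i = x (i + k)`. -/
def shiftBy {A : Type} (k : ℤ) (x : ℤ → A) : ℤ → A := fun i => x (i + k)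

/-- The shift map `S`, `(S x) i = x (i + 1)`. -/
def shift {A : Type} (x : ℤ → A) : ℤ → A := shiftBy 1 x

/-- The finite subword `x[i, i + n)` of a bi-infinite word. -/
def window {A : Type} (x : ℤ → A) (i : ℤ) (n : ℕ) : List A :=
  List.ofFn fun j : Fin n => x (i + (j : ℕ))

/-! ### The space of subshifts with a finite alphabet contained in `ℤ` -/

/-- A subshift over some finite alphabet contained in `ℤ`: a closed subset `X` of `A ^ ℤ`, with
`A ⊆ ℤ` finite, such that `S X = X`. -/
@[ext] structure Subshift where
  carrier : Set (ℤ → ℤ)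
  finite_alphabet : ∃ A : Finset ℤ, ∀ x ∈ carrier, ∀ i, x i ∈ A
  isClosed : IsClosed carrier
  shift_image : shift '' carrier = carrier

/-- `L_n(X)`: the set of words of length `n` that occur in some element of `X`. -/
def Subshift.lang (X : Subshift) (n : ℕ) : Set (List ℤ) :=
  {w | ∃ x ∈ X.carrier, ∃ i : ℤ, w = window x i n}

theorem Subshift.shift_mem (X : Subshift) {x : ℤ → ℤ} (hx : x ∈ X.carrier) :
    shift x ∈ X.carrier := by
  rw [← X.shift_image]; exact ⟨x, hx, rfl⟩

theorem Subshift.shiftBy_neg_one_mem (X : Subshift) {x : ℤ → ℤ} (hx : x ∈ X.carrier) :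
    shiftBy (-1) x ∈ X.carrier := by
  rw [← X.shift_image] at hx
  obtain ⟨y, hy, rfl⟩ := hx
  have : shiftBy (-1) (shift y) = y := by
    funext i; simp [shiftBy, shift]
  rwa [this]

theorem Subshift.shiftBy_mem (X : Subshift) (k : ℤ) :
    ∀ x ∈ X.carrier, shiftBy k x ∈ X.carrier := by
  induction k using Int.induction_on with
  | zero =>
    intro x hx
    have : shiftBy 0 x = x := by funext i; simp [shiftBy]
    rwa [this]
  | succ n ih =>
    intro x hx
    have : shiftBy ((n : ℤ) + 1) x = shift (shiftBy n x) := by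
      funext i; simp only [shiftBy, shift]; congr 1; ring
    rw [this]; exact X.shift_mem (ih x hx)
  | pred n ih =>
    intro x hx
    have : shiftBy (-(n : ℤ) - 1) x = shiftBy (-1) (shiftBy (-(n : ℤ)) x) := by
      funext i; simp only [shiftBy]; congr 1; ring
    rw [this]; exact X.shiftBy_neg_one_mem (ih x hx)

theorem Subshift.le_of_lang_eq {X Y : Subshift} (h : ∀ n, X.lang n = Y.lang n) :
    X.carrier ⊆ Y.carrier := by
  intro x hx
  have key : ∀ n : ℕ, ∃ z ∈ Y.carrier, ∀ i : ℤ, -(n : ℤ) ≤ i → i ≤ n → z i = x i := by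
    intro n
    have hw : window x (-(n : ℤ)) (2 * n + 1) ∈ Y.lang (2 * n + 1) := by
      rw [← h]; exact ⟨x, hx, _, rfl⟩
    obtain ⟨y, hy, i, hi⟩ := hw
    refine ⟨shiftBy (i + n) y, Y.shiftBy_mem _ y hy, fun j h1 h2 => ?_⟩
    have h3 := congrFun (List.ofFn_injective hi) ⟨(j + n).toNat, by omega⟩
    have h4 : (((j + n).toNat : ℕ) : ℤ) = j + n := Int.toNat_of_nonneg (by omega)
    simp only [h4] at h3
    simp only [shiftBy]
    rw [show j + (i + (n : ℤ)) = i + (j + n) by ring, ← h3]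
    congr 1; ring
  choose z hz hzx using key
  refine Y.isClosed.mem_of_tendsto (f := z) (b := atTop) ?_ (Eventually.of_forall hz)
  rw [tendsto_pi_nhds]
  intro i
  refine tendsto_const_nhds.congr' ?_
  filter_upwards [eventually_ge_atTop i.natAbs] with n hn
  exact (hzx n i (by omega) (by omega)).symm

theorem Subshift.eq_of_lang_eq {X Y : Subshift} (h : ∀ n, X.lang n = Y.lang n) : X = Y :=
  Subshift.ext (Set.Subset.antisymm (le_of_lang_eq h) (le_of_lang_eq fun n => (h n).symm))

open Classical in
/-- `d(X, Y) = 2 ^ (- inf {n | L_n(X) ≠ L_n(Y)})`, with the convention `2 ^ (-∞) = 0`. -/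
noncomputable def Subshift.distance (X Y : Subshift) : ℝ :=
  if X = Y then 0 else (1 / 2 : ℝ) ^ sInf {n : ℕ | X.lang n ≠ Y.lang n}

theorem Subshift.distance_comm (X Y : Subshift) : X.distance Y = Y.distance X := by
  by_cases h : X = Y
  · rw [h]
  · simp only [distance, if_neg h, if_neg (Ne.symm h), ne_comm (a := X.lang _)]

theorem Subshift.distance_triangle (X Y Z : Subshift) :
    X.distance Z ≤ X.distance Y + Y.distance Z := by
  have nonneg : ∀ U V : Subshift, 0 ≤ U.distance V := fun U V => by
    unfold distance; split_ifs <;> positivity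
  by_cases hXY : X = Y
  · subst hXY; linarith [nonneg X X]
  by_cases hYZ : Y = Z
  · subst hYZ; linarith [nonneg Y Y]
  by_cases hXZ : X = Z
  · subst hXZ
    have : X.distance X = 0 := by simp [distance]
    linarith [nonneg X Y, nonneg Y X]
  have hne : {n : ℕ | X.lang n ≠ Z.lang n}.Nonempty := by
    by_contra hcon
    rw [Set.not_nonempty_iff_eq_empty] at hcon
    refine hXZ (eq_of_lang_eq fun n => ?_)
    by_contra hn
    have : n ∈ {n : ℕ | X.lang n ≠ Z.lang n} := hn
    rw [hcon] at this; exact this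
  have hmem := Nat.sInf_mem hne
  set m := sInf {n : ℕ | X.lang n ≠ Z.lang n} with hm
  have hor : X.lang m ≠ Y.lang m ∨ Y.lang m ≠ Z.lang m := by
    by_contra hcon
    push Not at hcon
    exact hmem (hcon.1.trans hcon.2)
  have hXZd : X.distance Z = (1 / 2 : ℝ) ^ m := by simp only [distance, if_neg hXZ, ← hm]
  rcases hor with h | h
  · have : X.distance Z ≤ X.distance Y := by
      rw [hXZd]; simp only [distance, if_neg hXY]
      exact pow_le_pow_of_le_one (by norm_num) (by norm_num) (Nat.sInf_le h)
    linarith [nonneg Y Z]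
  · have : X.distance Z ≤ Y.distance Z := by
      rw [hXZd]; simp only [distance, if_neg hYZ]
      exact pow_le_pow_of_le_one (by norm_num) (by norm_num) (Nat.sInf_le h)
    linarith [nonneg X Y]

/-- The metric space of all subshifts with a finite alphabet contained in `ℤ`. -/
noncomputable instance : MetricSpace Subshift where
  dist := Subshift.distance
  dist_self X := by simp [Subshift.distance]
  dist_comm := Subshift.distance_comm
  dist_triangle := Subshift.distance_triangle
  eq_of_dist_eq_zero := by
    intro X Y h
    by_contra hne
    have h' : Subshift.distance X Y = 0 := h
    simp [Subshift.distance, hne] at h'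

/-- A subshift is minimal if the orbit of each of its points is dense in it. -/
def Subshift.IsMinimal (X : Subshift) : Prop :=
  ∀ x ∈ X.carrier, X.carrier ⊆ closure {y | ∃ k : ℤ, y = shiftBy k x}

/-- The space of all infinite minimal subshifts, with the subspace topology. -/
abbrev InfiniteMinimalSubshift : Type :=
  {X : Subshift // X.carrier.Infinite ∧ X.IsMinimal}

/-- A subset is generic if it contains a dense `G_δ` set. -/
def IsGeneric {X : Type} [TopologicalSpace X] (s : Set X) : Prop :=
  ∃ t : Set X, t ⊆ s ∧ IsGδ t ∧ Dense t

/-! ### Morphisms, directive sequences and `S`-adic subshifts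

A morphism `A^* → B^*` is given by the images `τ a : List B` of the letters `a : A`; the image of
a word `w` is `w.flatMap τ`. -/

/-- `x = τ(y) = ⋯ τ(y(-1)) . τ(y(0)) τ(y(1)) ⋯`: the word `τ(y(i))` occupies the positions
`[c i, c (i + 1))` of `x`, and `c 0 = 0`. For a non-erasing `τ` there is exactly one such `x`
for each `y`. -/
def IsImage {A B : Type} (τ : A → List B) (y : ℤ → A) (x : ℤ → B) : Prop :=
  ∃ c : ℤ → ℤ, c 0 = 0 ∧ ∀ i : ℤ,
    c (i + 1) = c i + (τ (y i)).length ∧ window x (c i) (τ (y i)).length = τ (y i)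

/-- `(y, k)` is a centered `τ`-representation of `x`: `x = S ^ k τ(y)` and
`0 ≤ k < |τ(y(0))|`. -/
def IsCenteredRep {A B : Type} (τ : A → List B) (x : ℤ → B) (y : ℤ → A) (k : ℤ) : Prop :=
  (∃ z, IsImage τ y z ∧ x = shiftBy k z) ∧ 0 ≤ k ∧ k < (τ (y 0)).length

/-- `τ` is recognizable in `Y`: every `x` has at most one centered `τ`-representation in `Y`. -/
def RecognizableIn {A B : Type} (τ : A → List B) (Y : Set (ℤ → A)) : Prop :=
  ∀ (x : ℤ → B) (y y' : ℤ → A) (k k' : ℤ), y ∈ Y → y' ∈ Y →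
    IsCenteredRep τ x y k → IsCenteredRep τ x y' k' → y = y' ∧ k = k'

/-- A directive sequence `(τ_n : A_{n+1}^* → A_n^*)_{n ≥ 0}` of non-erasing morphisms between
finite (nonempty) alphabets. -/
structure DirectiveSequence where
  A : ℕ → Type
  finite : ∀ n, Finite (A n)
  nonempty : ∀ n, Nonempty (A n)
  τ : ∀ n, A (n + 1) → List (A n)
  nonerasing : ∀ n a, τ n a ≠ []

namespace DirectiveSequence

/-- Alphabets carry the discrete topology. -/
instance (σ : DirectiveSequence) (n : ℕ) : TopologicalSpace (σ.A n) := ⊥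

instance (σ : DirectiveSequence) (n : ℕ) : DiscreteTopology (σ.A n) := ⟨rfl⟩

variable (σ : DirectiveSequence)

/-- `σ.comp n k` is the composition `τ_{[n, n+k)} = τ_n ∘ ⋯ ∘ τ_{n+k-1}` on letters. -/
def comp (n : ℕ) : (k : ℕ) → σ.A (n + k) → List (σ.A n)
  | 0 => fun a => [a]
  | k + 1 => fun a => (σ.τ (n + k) a).flatMap (comp n k)

/-- `L^{(n)}`: the words that occur in `τ_{[n,N)}(a)` for some `N > n` and `a ∈ A_N`. -/
def lang (n : ℕ) : Set (List (σ.A n)) :=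
  {w | ∃ k > 0, ∃ a : σ.A (n + k), w <:+: σ.comp n k a}

/-- `X^{(n)}`: the bi-infinite words all of whose finite subwords are subwords of words
in `L^{(n)}`. -/
def subshift (n : ℕ) : Set (ℤ → σ.A n) :=
  {x | ∀ (i : ℤ) (m : ℕ), ∃ w ∈ σ.lang n, window x i m <:+: w}

def IsConstantLength : Prop :=
  ∀ n, ∃ ℓ : ℕ, ∀ a, (σ.τ n a).length = ℓ

def IsPrimitive : Prop :=
  ∀ n, ∃ k > 0, ∀ (a : σ.A (n + k)) (b : σ.A n), b ∈ σ.comp n k a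

def IsProper : Prop :=
  ∀ n, ∃ p q : σ.A n, ∀ a, (σ.τ n a).head? = some p ∧ (σ.τ n a).getLast? = some q

def IsRecognizable : Prop :=
  ∀ n, RecognizableIn (σ.τ n) (σ.subshift (n + 1))

/-- The alphabet rank `liminf_n |A_n|`. -/
noncomputable def alphabetRank : ℕ∞ :=
  liminf (fun n => (Nat.card (σ.A n) : ℕ∞)) atTop

end DirectiveSequence

/-- Topological conjugacy of two shift-invariant sets. -/
def Conjugate {A B : Type} [TopologicalSpace A] [TopologicalSpace B]
    (X : Set (ℤ → A)) (Y : Set (ℤ → B)) : Prop :=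
  ∃ φ : X ≃ₜ Y, ∀ x x' : X, x'.1 = shift x.1 → (φ x').1 = shift (φ x).1

/-- Strong Toeplitz subshifts of rank `K` (used for `K ≥ 2`). -/
def IsStrongToeplitz (K : ℕ) (X : Subshift) : Prop :=
  ∃ σ : DirectiveSequence,
    σ.IsConstantLength ∧ σ.IsPrimitive ∧ σ.IsProper ∧ σ.IsRecognizable ∧
      σ.alphabetRank ≤ (K : ℕ∞) ∧ Conjugate X.carrier (σ.subshift 0)

/-- Strong Toeplitz subshifts of finite rank. -/
def IsStrongToeplitzOfFiniteRank (X : Subshift) : Prop :=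
  ∃ K : ℕ, 2 ≤ K ∧ IsStrongToeplitz K X

end StrongToeplitz

open Filter Topology

namespace StrongToeplitz

/-! ### Windows -/

section Window

variable {A : Type}

/-! Polishness. Subshifts form a complete separable metric space, since a Cauchy sequence has
eventually constant languages of each length. Being infinite and minimal amounts to countably many
conditions, each decided by the words of some bounded length: for each `n` the words of length `n`
recur within some bound, and no `p > 0` is a period of all points. So the space of infinite minimal
subshifts is a `G_δ`.

Genericity. The dense `G_δ` is the set of all `X` with `HasMarkedBlocks n` for every `n > 0`: every
point is cut into two blocks `u`, `v` of equal length that share a prefix of length `n` and occur at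
cutting points only. For fixed `n > 0` this is open, being decided by the words of twice the block
length.

Marked blocks give rank two (`Level.exists_refines`). If the shared prefix is long compared with a
given coding of `X` by words of constant length, the cutting points can be moved inside the prefix
to a cutting point of that coding. The moved blocks are at most two words, factor over the old
words, and begin and end with the same old words because both ends lie in copies of the prefix. By
minimality they contain every old word. Iterating from the letters gives a directive sequence that
is proper, primitive, of constant length and of rank at most two. It is recognizable since cutting
points are visible in the points of `X`.

Density (`Subshift.exists_hasMarkedBlocks`). Let `x[0, p)` and `x[0, q)` be suitable return words to
the prefix of length `N` of a point `x` of `X`. Concatenations of `c = x[0, p) x[0, q)` and `d =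
x[0, q) x[0, p)` have the `N`-words of `X`, and `c ≠ d` for a good choice of `q`. What remains is an
infinite minimal binary subshift to be spelled with `c` and `d`. It is `X` itself, coded by two
binary words of length `n + 6` that have a long common prefix and are found by their initial `001`.
The word `ccd` in turn synchronizes the concatenations of `c` and `d`. -/

@[simp] theorem length_window (x : ℤ → A) (i : ℤ) (n : ℕ) : (window x i n).length = n := by
  simp [window]

@[simp] theorem getElem_window (x : ℤ → A) (i : ℤ) (n r : ℕ) (h : r < (window x i n).length) :
    (window x i n)[r] = x (i + r) := by
  simp [window]

theorem window_eq_iff {x y : ℤ → A} {i j : ℤ} {n : ℕ} :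
    window x i n = window y j n ↔ ∀ r : ℤ, 0 ≤ r → r < n → x (i + r) = y (j + r) := by
  constructor
  · intro h r h0 h1
    have := congrFun (List.ofFn_injective h) ⟨r.toNat, by omega⟩
    simpa [Int.toNat_of_nonneg h0] using this
  · intro h
    refine List.ext_getElem (by simp) fun r h1 _ => ?_
    rw [length_window] at h1
    simpa using h r (by omega) (by omega)

theorem window_shiftBy (k : ℤ) (x : ℤ → A) (i : ℤ) (n : ℕ) :
    window (shiftBy k x) i n = window x (i + k) n := by
  refine List.ext_getElem (by simp) fun r _ _ => ?_
  simp only [getElem_window, shiftBy]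
  congr 1; ring

theorem take_window (x : ℤ → A) (i : ℤ) {m n : ℕ} (h : m ≤ n) :
    (window x i n).take m = window x i m := by
  refine List.ext_getElem (by simp [h]) fun r _ _ => ?_
  simp

theorem window_add (x : ℤ → A) (i : ℤ) (m n : ℕ) :
    window x i (m + n) = window x i m ++ window x (i + m) n := by
  refine List.ext_getElem (by simp) fun r h1 h2 => ?_
  rw [List.getElem_append]
  split_ifs with h
  · simp
  · simp only [length_window] at h ⊢
    simp only [getElem_window]
    congr 1; omega

theorem exists_eq_window_of_isInfix {x : ℤ → A} {i : ℤ} {n : ℕ} {w : List A}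
    (h : w <:+: window x i n) : ∃ j, i ≤ j ∧ j + w.length ≤ i + n ∧ w = window x j w.length := by
  obtain ⟨s, t, h⟩ := h
  have hl := congrArg List.length h
  simp only [List.length_append, length_window] at hl
  refine ⟨i + s.length, by omega, by omega, List.ext_getElem (by simp) fun r h1 _ => ?_⟩
  have h2 : (window x i n)[s.length + r]'(by simp; omega) = w[r] := by
    simp [← h, h1]
  rw [← h2]
  simp only [getElem_window]
  congr 1; push_cast; ring

theorem window_isInfix_window (x : ℤ → A) {i j : ℤ} {m n : ℕ} (h1 : i ≤ j) (h2 : j + m ≤ i + n) :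
    window x j m <:+: window x i n := by
  obtain ⟨a, rfl⟩ : ∃ a : ℕ, j = i + a := ⟨(j - i).toNat, by omega⟩
  obtain ⟨b, rfl⟩ : ∃ b : ℕ, n = a + m + b := ⟨n - (a + m), by omega⟩
  rw [window_add, window_add]
  exact ⟨_, _, rfl⟩

theorem isClopen_setOf_window_mem [TopologicalSpace A] [DiscreteTopology A] (i : ℤ) (n : ℕ)
    (S : Set (List A)) : IsClopen {x : ℤ → A | window x i n ∈ S} := by
  have : Continuous fun (x : ℤ → A) (j : Fin n) => x (i + (j : ℕ)) := by fun_prop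
  exact (isClopen_discrete {f : Fin n → A | List.ofFn f ∈ S}).preimage this

theorem shiftBy_shiftBy (j k : ℤ) (x : ℤ → A) : shiftBy j (shiftBy k x) = shiftBy (j + k) x := by
  funext i; simp only [shiftBy]; congr 1; ring

@[simp] theorem shiftBy_zero (x : ℤ → A) : shiftBy 0 x = x := by
  funext i; simp [shiftBy]

theorem continuous_shiftBy [TopologicalSpace A] (k : ℤ) :
    Continuous (shiftBy k : (ℤ → A) → ℤ → A) := by
  unfold shiftBy; fun_prop

theorem tendsto_of_window_eq [TopologicalSpace A] {z : ℕ → ℤ → A} {x : ℤ → A}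
    (h : ∀ n : ℕ, window (z n) (-n) (2 * n) = window x (-n) (2 * n)) :
    Tendsto z atTop (𝓝 x) := by
  rw [tendsto_pi_nhds]
  intro i
  refine tendsto_const_nhds.congr' ?_
  filter_upwards [eventually_gt_atTop i.natAbs] with n hn
  have := window_eq_iff.1 (h n) (i + n) (by omega) (by push_cast; omega)
  simpa using this.symm

end Window

/-! ### Languages of subshifts and the metric -/

namespace Subshift

/-- A subshift from a closed set that is invariant under all powers of the shift. -/
def ofInvariant (Z : Set (ℤ → ℤ)) (hA : ∃ A : Finset ℤ, ∀ x ∈ Z, ∀ i, x i ∈ A) (hZ : IsClosed Z)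
    (h : ∀ k, ∀ x ∈ Z, shiftBy k x ∈ Z) : Subshift where
  carrier := Z
  finite_alphabet := hA
  isClosed := hZ
  shift_image := by
    refine Set.Subset.antisymm ?_ fun x hx => ⟨shiftBy (-1) x, h _ _ hx, ?_⟩
    · rintro _ ⟨x, hx, rfl⟩
      exact h 1 x hx
    · rw [shift, shiftBy_shiftBy]; simp

variable {X Y : Subshift}

theorem window_mem_lang {x : ℤ → ℤ} (hx : x ∈ X.carrier) (i : ℤ) (n : ℕ) :
    window x i n ∈ X.lang n := ⟨x, hx, i, rfl⟩

theorem exists_window_eq_of_mem_lang {n : ℕ} {w : List ℤ} (hw : w ∈ X.lang n) (i : ℤ) :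
    ∃ x ∈ X.carrier, window x i n = w := by
  obtain ⟨x, hx, j, rfl⟩ := hw
  exact ⟨shiftBy (j - i) x, X.shiftBy_mem _ x hx, by rw [window_shiftBy]; congr 1; ring⟩

theorem lang_eq_image_take {m n : ℕ} (h : m ≤ n) : X.lang m = List.take m '' X.lang n := by
  ext w
  constructor
  · rintro ⟨x, hx, i, rfl⟩
    exact ⟨_, window_mem_lang hx i n, take_window x i h⟩
  · rintro ⟨_, ⟨x, hx, i, rfl⟩, rfl⟩
    rw [take_window x i h]
    exact window_mem_lang hx i m

theorem lang_eq_of_le {m n : ℕ} (h : m ≤ n) (hn : X.lang n = Y.lang n) : X.lang m = Y.lang m := by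
  rw [lang_eq_image_take h, hn, ← lang_eq_image_take h]

theorem finite_lang (X : Subshift) (n : ℕ) : (X.lang n).Finite := by
  obtain ⟨A, hA⟩ := X.finite_alphabet
  refine ((Set.Finite.pi' (t := fun _ : Fin n => (A : Set ℤ))
    fun _ => A.finite_toSet).image List.ofFn).subset ?_
  rintro _ ⟨x, hx, i, rfl⟩
  exact ⟨fun j : Fin n => x (i + (j : ℕ)), fun j => hA x hx _, rfl⟩

theorem mem_of_window_mem {x : ℤ → ℤ}
    (h : ∀ n : ℕ, window x (-n) (2 * n) ∈ X.lang (2 * n)) : x ∈ X.carrier := by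
  choose z hz hzx using fun n => exists_window_eq_of_mem_lang (h n) (-n)
  exact X.isClosed.mem_of_tendsto (tendsto_of_window_eq hzx) (Eventually.of_forall hz)

theorem isCompact (X : Subshift) : IsCompact X.carrier := by
  obtain ⟨A, hA⟩ := X.finite_alphabet
  refine (isCompact_univ_pi fun _ : ℤ => A.finite_toSet.isCompact).of_isClosed_subset
    X.isClosed fun x hx i _ => hA x hx i

theorem lang_eq_of_dist_lt {m : ℕ} (h : dist X Y < (1 / 2 : ℝ) ^ m) : X.lang m = Y.lang m := by
  by_contra hne
  have hXY : X ≠ Y := by rintro rfl; exact hne rfl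
  have : dist X Y = (1 / 2 : ℝ) ^ sInf {n : ℕ | X.lang n ≠ Y.lang n} := if_neg hXY
  rw [this] at h
  exact absurd h (not_lt.2 (pow_le_pow_of_le_one (by norm_num) (by norm_num) (Nat.sInf_le hne)))

theorem dist_le_of_lang_eq {m : ℕ} (h : X.lang m = Y.lang m) : dist X Y ≤ (1 / 2 : ℝ) ^ m := by
  by_cases hXY : X = Y
  · subst hXY; rw [dist_self]; positivity
  have : dist X Y = (1 / 2 : ℝ) ^ sInf {n : ℕ | X.lang n ≠ Y.lang n} := if_neg hXY
  rw [this]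
  refine pow_le_pow_of_le_one (by norm_num) (by norm_num) (le_csInf ?_ fun n hn => ?_)
  · by_contra hcon
    rw [Set.not_nonempty_iff_eq_empty, Set.eq_empty_iff_forall_notMem] at hcon
    exact hXY (eq_of_lang_eq fun n => not_not.1 (hcon n))
  · by_contra hlt
    exact hn (lang_eq_of_le (by omega) h)

theorem exists_pow_lt_of_pos {ε : ℝ} (hε : 0 < ε) : ∃ m : ℕ, (1 / 2 : ℝ) ^ m < ε :=
  exists_pow_lt_of_lt_one hε (by norm_num)

theorem isOpen_of_lang {s : Set Subshift}
    (h : ∀ X ∈ s, ∃ m, ∀ Y : Subshift, Y.lang m = X.lang m → Y ∈ s) : IsOpen s := by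
  rw [Metric.isOpen_iff]
  intro X hX
  obtain ⟨m, hm⟩ := h X hX
  exact ⟨(1 / 2 : ℝ) ^ m, by positivity, fun Y hY => hm Y (lang_eq_of_dist_lt hY)⟩

instance : SecondCountableTopology Subshift := by
  refine Metric.secondCountable_of_countable_discretization fun ε hε => ?_
  obtain ⟨m, hm⟩ := exists_pow_lt_of_pos hε
  refine ⟨Finset (List ℤ), inferInstance, fun X => (X.finite_lang m).toFinset, fun X Y h => ?_⟩
  exact (dist_le_of_lang_eq (Set.Finite.toFinset_inj.1 h)).trans hm.le

/-- The limit consists of all points whose words of each length `m` lie in the eventual value of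
`L_m`. Compactness shows that all words of that value occur in it. -/
instance : CompleteSpace Subshift := by
  refine Metric.complete_of_cauchySeq_tendsto fun u hu => ?_
  have hstab : ∀ m, ∃ K, ∀ k ≥ K, (u k).lang m = (u K).lang m := fun m => by
    obtain ⟨K, hK⟩ := Metric.cauchySeq_iff'.1 hu ((1 / 2) ^ m) (by positivity)
    exact ⟨K, fun k hk => lang_eq_of_dist_lt (hK k hk)⟩
  choose K hK using hstab
  obtain ⟨A, hA⟩ := (u (K 1)).finite_alphabet
  have hletter : ∀ x : ℤ → ℤ, ∀ i, window x i 1 ∈ (u (K 1)).lang 1 → x i ∈ A := by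
    rintro x i ⟨y, hy, j, h⟩
    have := window_eq_iff.1 h 0 le_rfl (by norm_num)
    simp only [add_zero] at this
    rw [this]; exact hA y hy j
  let Z : Set (ℤ → ℤ) := {x | ∀ i m, window x i m ∈ (u (K m)).lang m}
  have hZ : IsClosed Z := by
    simp only [Z, Set.ofPred_forall]
    exact isClosed_iInter fun i => isClosed_iInter fun m =>
      (isClopen_setOf_window_mem i m _).isClosed
  let X : Subshift := ofInvariant Z ⟨A, fun x hx i => hletter x i (hx i 1)⟩ hZ
    fun k x hx i m => by rw [window_shiftBy]; exact hx _ m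
  have hX : ∀ m, X.lang m = (u (K m)).lang m := by
    intro m
    refine Set.Subset.antisymm ?_ fun w hw => ?_
    · rintro _ ⟨x, hx, i, rfl⟩
      exact hx i m
    -- Points that show `w` at `0` and are admissible up to length `t`: decreasing compact sets,
    -- nonempty since a late term of the sequence provides a point.
    let C : ℕ → Set (ℤ → ℤ) := fun t => {x | (∀ i, x i ∈ A) ∧ window x 0 m ∈ ({w} : Set _) ∧
      ∀ i, ∀ s ≤ t, window x i s ∈ (u (K s)).lang s}
    have hclosed : ∀ t, IsClosed (C t) := by
      intro t
      refine IsClosed.and ?_ (IsClosed.and (isClopen_setOf_window_mem _ _ _).isClosed ?_)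
      · simp only [Set.ofPred_forall]
        exact isClosed_iInter fun i =>
          (isClosed_discrete (A : Set ℤ)).preimage (continuous_apply i)
      · simp only [Set.ofPred_forall]
        exact isClosed_iInter fun i => isClosed_iInter fun s => isClosed_iInter fun _ =>
          (isClopen_setOf_window_mem i s _).isClosed
    obtain ⟨x, hx⟩ := IsCompact.nonempty_iInter_of_sequence_nonempty_isCompact_isClosed C
      (fun t x hx => ⟨hx.1, hx.2.1, fun i s hs => hx.2.2 i s (by omega)⟩) (fun t => by
        obtain ⟨k, hk⟩ := ((Finset.range (t + m + 2)).image K).exists_le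
        have hk' : ∀ s < t + m + 2, (u k).lang s = (u (K s)).lang s := fun s hs =>
          hK s k (hk _ (Finset.mem_image_of_mem K (Finset.mem_range.2 hs)))
        rw [← hk' m (by omega)] at hw
        obtain ⟨x, hx, rfl⟩ := exists_window_eq_of_mem_lang hw 0
        refine ⟨x, fun i => hletter x i ?_, rfl, fun i s hs => ?_⟩
        · rw [← hk' 1 (by omega)]; exact window_mem_lang hx i 1
        · rw [← hk' s (by omega)]; exact window_mem_lang hx i s)
      ((isCompact_univ_pi fun _ : ℤ => A.finite_toSet.isCompact).of_isClosed_subset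
        (hclosed 0) fun x hx i _ => hx.1 i) hclosed
    rw [Set.mem_iInter] at hx
    exact ⟨x, fun i s => (hx s).2.2 i s le_rfl, 0, (hx 0).2.1.symm⟩
  refine ⟨X, Metric.tendsto_atTop.2 fun ε hε => ?_⟩
  obtain ⟨m, hm⟩ := exists_pow_lt_of_pos hε
  exact ⟨K m, fun k hk => (dist_le_of_lang_eq ((hK m k hk).trans (hX m).symm)).trans_lt hm⟩

/-! ### Minimal subshifts and infinite subshifts -/

/-- Every word of length `n` of `X` occurs in each window of length `M + n` of each point. -/
def RecurrentWithin (X : Subshift) (n M : ℕ) : Prop :=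
  ∀ x ∈ X.carrier, ∀ w ∈ X.lang n, ∃ i : ℤ, 0 ≤ i ∧ i < M ∧ window x i n = w

theorem IsMinimal.exists_window_eq (h : X.IsMinimal) {x : ℤ → ℤ} (hx : x ∈ X.carrier) {n : ℕ}
    {w : List ℤ} (hw : w ∈ X.lang n) : ∃ i, window x i n = w := by
  obtain ⟨y, hy, rfl⟩ := exists_window_eq_of_mem_lang hw 0
  obtain ⟨_, hz, k, rfl⟩ := mem_closure_iff.1 (h x hx hy)
    {z | window z 0 n ∈ ({window y 0 n} : Set _)}
    (isClopen_setOf_window_mem _ _ _).isOpen rfl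
  exact ⟨0 + k, by rw [← window_shiftBy]; exact hz⟩

theorem IsMinimal.exists_recurrentWithin (h : X.IsMinimal) (n : ℕ) :
    ∃ M, X.RecurrentWithin n M := by
  have key : ∀ w ∈ X.lang n, ∃ M : ℕ, ∀ x ∈ X.carrier, ∃ i : ℤ,
      0 ≤ i ∧ i < M ∧ window x i n = w := by
    intro w hw
    obtain ⟨t, ht⟩ := X.isCompact.elim_finite_subcover
      (fun i : ℤ => {x : ℤ → ℤ | window x i n ∈ ({w} : Set _)})
      (fun i => (isClopen_setOf_window_mem i n _).isOpen)
      (fun x hx => Set.mem_iUnion.2 (h.exists_window_eq hx hw))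
    obtain ⟨b, hb⟩ := (t.image Int.natAbs).exists_le
    refine ⟨2 * b + 1, fun x hx => ?_⟩
    have := ht (X.shiftBy_mem b x hx)
    simp only [Set.mem_iUnion, Set.mem_ofPred_eq, Set.mem_singleton_iff] at this
    obtain ⟨i, hi, hw⟩ := this
    have := hb _ (Finset.mem_image_of_mem _ hi)
    rw [window_shiftBy] at hw
    exact ⟨i + b, by omega, by push_cast; omega, hw⟩
  choose! M hM using key
  obtain ⟨b, hb⟩ := ((X.finite_lang n).toFinset.image M).exists_le
  refine ⟨b, fun x hx w hw => ?_⟩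
  obtain ⟨i, h0, h1, h2⟩ := hM w hw x hx
  have := hb _ (Finset.mem_image_of_mem M ((X.finite_lang n).mem_toFinset.2 hw))
  exact ⟨i, h0, by omega, h2⟩

theorem isMinimal_iff : X.IsMinimal ↔ ∀ n, ∃ M, X.RecurrentWithin n M := by
  refine ⟨fun h n => h.exists_recurrentWithin n, fun h x hx y hy => ?_⟩
  have key : ∀ n : ℕ, ∃ k : ℤ, window (shiftBy k x) (-n) (2 * n) = window y (-n) (2 * n) := by
    intro n
    obtain ⟨M, hM⟩ := h (2 * n)
    obtain ⟨i, -, -, hi⟩ := hM x hx _ (window_mem_lang hy (-n) (2 * n))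
    exact ⟨i + n, by rw [window_shiftBy, ← hi]; congr 1; ring⟩
  choose k hk using key
  exact mem_closure_of_tendsto (tendsto_of_window_eq hk) (Eventually.of_forall fun n => ⟨k n, rfl⟩)

/-- A window of length `M + n` already contains the required occurrences, so the property depends on
these windows alone. This makes it open. -/
theorem RecurrentWithin.of_lang_eq {n M : ℕ} (h : X.RecurrentWithin n M)
    (hXY : Y.lang (M + n) = X.lang (M + n)) : Y.RecurrentWithin n M := by
  intro y hy w hw
  have hy' := window_mem_lang hy 0 (M + n)
  rw [hXY] at hy'
  obtain ⟨x, hx, hxy⟩ := exists_window_eq_of_mem_lang hy' 0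
  rw [lang_eq_of_le (by omega) hXY] at hw
  obtain ⟨i, h0, h1, rfl⟩ := h x hx w hw
  refine ⟨i, h0, h1, window_eq_iff.2 fun r hr0 hr1 => ?_⟩
  have := window_eq_iff.1 hxy (i + r) (by omega) (by push_cast; omega)
  simpa using this.symm

/-- No power of the shift is the identity on `X`. -/
def IsAperiodic (X : Subshift) : Prop := ∀ p : ℕ, 0 < p → ∃ x ∈ X.carrier, x 0 ≠ x p

/-- With a common period `p`, a point is determined by one of finitely many words of length `p`.
Conversely, the points of a finite subshift are periodic and the product of their periods is a
common period. -/
theorem infinite_iff_isAperiodic : X.carrier.Infinite ↔ X.IsAperiodic := by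
  constructor
  · intro hX p hp
    by_contra! hcon
    refine hX ?_
    have hper : ∀ x ∈ X.carrier, ∀ i, x i = x (i + p) := fun x hx i => by
      have := hcon _ (X.shiftBy_mem i x hx)
      simpa [shiftBy, add_comm] using this
    refine Set.Finite.of_finite_image (f := fun x => window x 0 p)
      ((X.finite_lang p).subset ?_) fun x hx y hy hxy => ?_
    · rintro _ ⟨x, hx, rfl⟩
      exact window_mem_lang hx 0 p
    · have hmod : ∀ x ∈ X.carrier, ∀ i, x i = x (i % p) := fun x hx i => by
        have : ∀ k : ℤ, ∀ j, x (j + p * k) = x j := fun k => by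
          induction k using Int.induction_on with
          | zero => simp
          | succ k ih =>
            intro j
            rw [← ih j, hper x hx (j + p * k)]
            congr 1; ring
          | pred k ih =>
            intro j
            rw [← ih j, hper x hx (j + p * (-k - 1))]
            congr 1; ring
        conv_lhs => rw [← Int.emod_add_mul_ediv i p, this]
      funext i
      rw [hmod x hx, hmod y hy]
      have := window_eq_iff.1 hxy (i % p) (Int.emod_nonneg _ (by omega))
        (Int.emod_lt_of_pos _ (by omega))
      simpa using this
  · intro h hfin
    have hper : ∀ x ∈ X.carrier, ∃ p : ℕ, 0 < p ∧ shiftBy p x = x := by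
      intro x hx
      obtain ⟨a, -, b, -, hab, he⟩ := Set.infinite_univ.exists_lt_map_eq_of_mapsTo
        (f := fun k : ℕ => shiftBy k x) (fun k _ => X.shiftBy_mem k x hx) hfin
      refine ⟨b - a, by omega, ?_⟩
      have := congrArg (shiftBy (-a)) he
      simp only [shiftBy_shiftBy, neg_add_cancel, shiftBy_zero] at this
      rw [Nat.cast_sub hab.le, sub_eq_neg_add, ← this]
    choose! p hp0 hp using hper
    obtain ⟨x, hx, hne⟩ := h (∏ x ∈ hfin.toFinset, p x)
      (Finset.prod_pos fun x hx => hp0 x (hfin.mem_toFinset.1 hx))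
    obtain ⟨q, hq⟩ := Finset.dvd_prod_of_mem p (hfin.mem_toFinset.2 hx)
    refine hne ?_
    rw [hq]
    clear hq hne
    have : ∀ q : ℕ, x 0 = x (p x * q : ℕ) := fun q => by
      induction q with
      | zero => simp
      | succ q ih =>
        rw [ih, ← congrFun (hp x hx) (p x * q : ℕ)]
        simp only [shiftBy]
        congr 1
    exact this q

theorem isGδ_setOf_infinite_isMinimal :
    ∃ U : ℕ → Set Subshift, (∀ n, IsOpen (U n)) ∧
      {X : Subshift | X.carrier.Infinite ∧ X.IsMinimal} = ⋂ n, U n := by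
  refine ⟨fun n => {X | (∃ M, X.RecurrentWithin n M) ∧ ∃ x ∈ X.carrier, x 0 ≠ x (n + 1 : ℕ)},
    fun n => ?_, ?_⟩
  · refine isOpen_of_lang ?_
    rintro X ⟨⟨M, hM⟩, x, hx, hne⟩
    refine ⟨M + n + 2, fun Y hY =>
      ⟨⟨M, hM.of_lang_eq (lang_eq_of_le (by omega) hY)⟩, ?_⟩⟩
    have hw := window_mem_lang hx 0 (n + 2)
    rw [← lang_eq_of_le (by omega) hY] at hw
    obtain ⟨y, hy, hyx⟩ := exists_window_eq_of_mem_lang hw 0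
    rw [window_eq_iff] at hyx
    have h0 := hyx 0 le_rfl (by omega)
    have h1 := hyx (n + 1 : ℕ) (by omega) (by push_cast; omega)
    simp only [zero_add] at h0 h1
    exact ⟨y, hy, by rwa [h0, h1]⟩
  · ext X
    simp only [Set.mem_ofPred_eq, Set.mem_iInter, infinite_iff_isAperiodic, isMinimal_iff]
    constructor
    · rintro ⟨h1, h2⟩ n
      exact ⟨h2 n, h1 (n + 1) n.succ_pos⟩
    · intro h
      refine ⟨fun p hp => ?_, fun n => (h n).1⟩
      obtain ⟨p, rfl⟩ := Nat.exists_eq_succ_of_ne_zero hp.ne'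
      exact (h p).2

end Subshift

/-! ### Polishness of the space of infinite minimal subshifts -/

theorem polishSpace_iInter_of_isOpen {α : Type*} [TopologicalSpace α] [PolishSpace α]
    {U : ℕ → Set α} (hU : ∀ n, IsOpen (U n)) : PolishSpace ↥(⋂ n, U n) := by
  have := fun n => (hU n).polishSpace
  -- The diagonal embedding has closed range: it is given by the equality of all coordinates.
  let f : ↥(⋂ n, U n) → ∀ n, U n := fun x n => ⟨x.1, Set.mem_iInter.1 x.2 n⟩
  have hf : Continuous f := by fun_prop
  have hemb : IsEmbedding f := by
    refine IsEmbedding.of_comp hf (g := fun g => (g 0).1) (by fun_prop) ?_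
    exact IsEmbedding.subtypeVal
  refine IsClosedEmbedding.polishSpace (f := f) ⟨hemb, ?_⟩
  have : Set.range f = {g | ∀ n, (g n).1 = (g 0).1} := by
    ext g
    constructor
    · rintro ⟨x, rfl⟩ n
      rfl
    · intro hg
      exact ⟨⟨(g 0).1, Set.mem_iInter.2 fun n => hg n ▸ (g n).2⟩,
        funext fun n => Subtype.ext (hg n).symm⟩
  rw [this]
  simp only [Set.ofPred_forall]
  exact isClosed_iInter fun n => isClosed_eq (by fun_prop) (by fun_prop)

theorem polishSpace_infiniteMinimalSubshift : PolishSpace InfiniteMinimalSubshift := by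
  obtain ⟨U, hU, h⟩ := Subshift.isGδ_setOf_infinite_isMinimal
  have := polishSpace_iInter_of_isOpen hU
  rw [← h] at this
  exact this

/-! ### Recognizable blocks with a long common prefix -/

/-- A local test for being a residue class modulo `ℓ`. It inspects stretches of length `ℓ` only, so
it transfers between subshifts with the same words of length `2 * ℓ`. -/
theorem exists_forall_iff_dvd_sub {B : ℤ → Prop} {ℓ : ℕ}
    (h1 : ∀ j : ℤ, ∃ i : ℤ, j ≤ i ∧ i < j + ℓ ∧ B i)
    (h2 : ∀ j : ℤ, B j → ∀ r : ℤ, 0 < r → r ≤ ℓ → (B (j + r) ↔ r = ℓ)) :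
    ∃ k, ∀ i, B i ↔ (ℓ : ℤ) ∣ i - k := by
  obtain ⟨k, hk0, hkl, hk⟩ := h1 0
  have hℓ : 0 < (ℓ : ℤ) := by omega
  have hmul : ∀ t : ℤ, B (k + ℓ * t) := fun t => by
    induction t using Int.induction_on with
    | zero => simpa using hk
    | succ t ih =>
      have := (h2 _ ih ℓ hℓ le_rfl).2 rfl
      rwa [show k + ℓ * ((t : ℤ) + 1) = k + ℓ * t + ℓ by ring]
    | pred t ih =>
      -- Going backwards: some `i` in the preceding stretch satisfies `B`, and its distance to the
      -- known point is at most `ℓ`, hence equal to `ℓ`.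
      obtain ⟨i, hi0, hi1, hi⟩ := h1 (k + ℓ * (-t - 1))
      have he : k + ℓ * (-t : ℤ) = k + ℓ * (-t - 1) + ℓ := by ring
      have := h2 i hi (k + ℓ * (-t : ℤ) - i) (by omega) (by omega)
      rw [add_sub_cancel] at this
      have := this.1 ih
      rwa [show k + ℓ * (-(t : ℤ) - 1) = i by omega]
  refine ⟨k, fun i => ⟨fun hi => ?_, ?_⟩⟩
  · rw [Int.dvd_iff_emod_eq_zero]
    by_contra hne
    have hr0 := Int.emod_nonneg (i - k) hℓ.ne'
    have hr1 := Int.emod_lt_of_pos (i - k) hℓ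
    have he := Int.emod_add_mul_ediv (i - k) ℓ
    have := h2 _ (hmul ((i - k) / ℓ)) ((i - k) % ℓ) (by omega) hr1.le
    rw [show k + ℓ * ((i - k) / ℓ) + (i - k) % ℓ = i by omega] at this
    have := this.1 hi
    omega
  · rintro ⟨t, ht⟩
    rw [show i = k + ℓ * t by omega]
    exact hmul t

/-- Each point of `X` is a concatenation of two words `u`, `v` of length `ℓ ≥ n` with a common
prefix of length `n`, and `u`, `v` occur only at the cutting points of this concatenation. -/
def Subshift.HasMarkedBlocks (X : Subshift) (n : ℕ) : Prop :=
  ∃ ℓ : ℕ, n ≤ ℓ ∧ ∃ u v : List ℤ, u.take n = v.take n ∧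
    ∀ x ∈ X.carrier, ∃ k : ℤ, ∀ i, (window x i ℓ = u ∨ window x i ℓ = v) ↔ (ℓ : ℤ) ∣ i - k

theorem Subshift.isOpen_setOf_hasMarkedBlocks {n : ℕ} (hn : 0 < n) :
    IsOpen {X : Subshift | X.HasMarkedBlocks n} := by
  refine isOpen_of_lang ?_
  rintro X ⟨ℓ, hℓ, u, v, huv, h⟩
  refine ⟨2 * ℓ, fun Y hY => ⟨ℓ, hℓ, u, v, huv, fun y hy => ?_⟩⟩
  have key : ∀ j : ℤ, ∃ x ∈ X.carrier, ∀ r : ℤ, 0 ≤ r → r ≤ ℓ →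
      window y (j + r) ℓ = window x (j + r) ℓ := by
    intro j
    have hw := window_mem_lang hy j (2 * ℓ)
    rw [hY] at hw
    obtain ⟨x, hx, hxy⟩ := exists_window_eq_of_mem_lang hw j
    refine ⟨x, hx, fun r hr0 hr1 => window_eq_iff.2 fun s hs0 hs1 => ?_⟩
    rw [add_assoc]
    exact (window_eq_iff.1 hxy (r + s) (by omega) (by push_cast; omega)).symm
  refine exists_forall_iff_dvd_sub (fun j => ?_) fun j hj r hr0 hr1 => ?_
  · obtain ⟨x, hx, hxy⟩ := key j
    obtain ⟨k, hk⟩ := h x hx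
    have hm0 := Int.emod_nonneg (k - j) (b := ℓ) (by omega)
    have hm1 := Int.emod_lt_of_pos (k - j) (b := ℓ) (by omega)
    refine ⟨j + (k - j) % ℓ, by omega, by omega, ?_⟩
    rw [hxy _ hm0 hm1.le, hk]
    refine ⟨-((k - j) / ℓ), ?_⟩
    have := Int.emod_add_mul_ediv (k - j) ℓ
    linarith
  · obtain ⟨x, hx, hxy⟩ := key j
    obtain ⟨k, hk⟩ := h x hx
    have h0 := hxy 0 le_rfl (by omega)
    rw [add_zero] at h0
    rw [h0, hk] at hj
    rw [hxy r hr0.le hr1, hk, show j + r - k = r + (j - k) by ring, Int.dvd_add_left hj]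
    constructor
    · intro hd
      exact le_antisymm hr1 (Int.le_of_dvd hr0 hd)
    · rintro rfl
      exact dvd_rfl

/-! ### Levels: codings of a subshift by blocks of constant length -/

/-- A coding of the points of `X` as concatenations of words of length `len`, whose cutting points
are detected by the occurrence of two consecutive words. -/
structure Level (X : Subshift) where
  len : ℕ
  len_pos : 0 < len
  words : Set (List ℤ)
  finite : words.Finite
  occurs : ∀ w ∈ words, ∃ x ∈ X.carrier, window x 0 len = w ∧ window x len len ∈ words
  sync : ∀ x ∈ X.carrier, ∃ k : ℤ, ∀ i : ℤ,
    (window x i len ∈ words ∧ window x (i + len) len ∈ words) ↔ (len : ℤ) ∣ i - k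

namespace Level

variable {X : Subshift}

def IsCut (L : Level X) (x : ℤ → ℤ) (i : ℤ) : Prop :=
  window x i L.len ∈ L.words ∧ window x (i + L.len) L.len ∈ L.words

theorem isCut_shiftBy (L : Level X) {x : ℤ → ℤ} {i k : ℤ} :
    L.IsCut (shiftBy k x) i ↔ L.IsCut x (i + k) := by
  simp only [IsCut, window_shiftBy, add_right_comm]

theorem IsCut.iff_dvd {L : Level X} {x : ℤ → ℤ} (hx : x ∈ X.carrier) {i j : ℤ}
    (hi : L.IsCut x i) : L.IsCut x j ↔ (L.len : ℤ) ∣ j - i := by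
  obtain ⟨k, hk⟩ := L.sync x hx
  have hik := (hk i).1 hi
  rw [IsCut, hk, show j - k = (j - i) + (i - k) by ring, Int.dvd_add_left hik]

theorem exists_isCut (L : Level X) {x : ℤ → ℤ} (hx : x ∈ X.carrier) (j : ℤ) :
    ∃ i, j ≤ i ∧ i < j + L.len ∧ L.IsCut x i := by
  obtain ⟨k, hk⟩ := L.sync x hx
  have hpos := L.len_pos
  have hm0 := Int.emod_nonneg (k - j) (b := L.len) (by omega)
  have hm1 := Int.emod_lt_of_pos (k - j) (b := L.len) (by omega)
  refine ⟨j + (k - j) % L.len, by omega, by omega, (hk _).2 ⟨-((k - j) / L.len), ?_⟩⟩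
  have := Int.emod_add_mul_ediv (k - j) L.len
  linarith

theorem length_eq (L : Level X) {w : List ℤ} (hw : w ∈ L.words) : w.length = L.len := by
  obtain ⟨x, -, rfl, -⟩ := L.occurs w hw
  simp

theorem isCut_of_window_eq {L : Level X} {x y : ℤ → ℤ} {i j : ℤ} (h : L.IsCut x i)
    (he : ∀ r : ℤ, 0 ≤ r → r < 2 * L.len → x (i + r) = y (j + r)) : L.IsCut y j := by
  have h1 : window y j L.len = window x i L.len :=
    window_eq_iff.2 fun r h0 h1 => (he r h0 (by omega)).symm
  have h2 : window y (j + L.len) L.len = window x (i + L.len) L.len :=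
    window_eq_iff.2 fun r h0 h1 => by
      simp only [add_assoc]
      exact (he _ (by omega) (by omega)).symm
  rw [IsCut, h1, h2]
  exact h

/-- The level whose words are the letters. -/
def letters (X : Subshift) : Level X where
  len := 1
  len_pos := one_pos
  words := X.lang 1
  finite := X.finite_lang 1
  occurs w hw := by
    obtain ⟨x, hx, rfl⟩ := Subshift.exists_window_eq_of_mem_lang hw 0
    exact ⟨x, hx, rfl, Subshift.window_mem_lang hx _ _⟩
  sync x hx := ⟨0, fun i => by simp [Subshift.window_mem_lang hx]⟩

/-- The concatenation of a list of words of a level. -/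
def flat (L : Level X) (l : List L.words) : List ℤ := (l.map Subtype.val).flatten

/-- The words of `L'` are concatenations of words of `L`, with a common first and a common last
word, and each of them uses all words of `L`. -/
structure Refines (L' L : Level X) : Prop where
  two_mul_len_le : 2 * L.len ≤ L'.len
  exists_factorization : ∃ p q : L.words, ∀ w ∈ L'.words, ∃ l : List L.words,
    L.flat l = w ∧ l.head? = some p ∧ l.getLast? = some q ∧ ∀ a, a ∈ l

theorem flatten_windows (x : ℤ → ℤ) (i : ℤ) (ℓ q : ℕ) :
    ((List.range q).map fun t : ℕ => window x (i + t * ℓ) ℓ).flatten = window x i (q * ℓ) := by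
  induction q with
  | zero => simp [window]
  | succ q ih =>
    rw [List.range_succ, List.map_append, List.flatten_append, ih, add_mul, one_mul, window_add]
    simp

/-- The cutting points of the marked blocks are moved by `φ` to a cutting point of `L` in the common
prefix. The words of the new level are the blocks between the moved points. -/
theorem exists_refines (hmin : X.IsMinimal) (hne : X.carrier.Nonempty)
    (hX : ∀ n, 0 < n → X.HasMarkedBlocks n) (L : Level X) :
    ∃ L' : Level X, L'.Refines L ∧ L'.words.encard ≤ 2 := by
  obtain ⟨M, hM⟩ := hmin.exists_recurrentWithin (2 * L.len)
  have hpos := L.len_pos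
  -- A cut `φ < 2 * L.len` together with the two words that witness it lies in the first `4 * L.len`
  -- letters. The summand `M` makes the block long enough to contain all words of `L`.
  obtain ⟨ℓ, hℓ, u, v, huv, hsync⟩ := hX (M + 4 * L.len) (by omega)
  -- the positions where the marked blocks occur
  let C : (ℤ → ℤ) → ℤ → Prop := fun x i => window x i ℓ = u ∨ window x i ℓ = v
  replace hsync : ∀ x ∈ X.carrier, ∃ k : ℤ, ∀ i, C x i ↔ (ℓ : ℤ) ∣ i - k := hsync
  have hCiff : ∀ x ∈ X.carrier, ∀ i j, C x i → (C x j ↔ (ℓ : ℤ) ∣ j - i) := by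
    intro x hx i j hi
    obtain ⟨k, hk⟩ := hsync x hx
    have hik := (hk i).1 hi
    rw [hk, show j - k = (j - i) + (i - k) by ring, Int.dvd_add_left hik]
  have hpre : ∀ {x y i j}, C x i → C y j → ∀ r : ℤ, 0 ≤ r → r < M + 4 * L.len →
      x (i + r) = y (j + r) := by
    intro x y i j hi hj r hr0 hr1
    have h1 : ∀ {x i}, C x i → window x i (M + 4 * L.len) = u.take (M + 4 * L.len) := by
      intro x i h
      rw [← take_window x i hℓ]
      rcases h with h | h
      · rw [h]
      · rw [h, huv]
    exact window_eq_iff.1 ((h1 hi).trans (h1 hj).symm) r hr0 (by push_cast; omega)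
  obtain ⟨x₀, hx₀, hC₀⟩ : ∃ x ∈ X.carrier, C x 0 := by
    obtain ⟨x, hx⟩ := hne
    obtain ⟨k, hk⟩ := hsync x hx
    refine ⟨shiftBy k x, X.shiftBy_mem k x hx, ?_⟩
    simp only [C, window_shiftBy, zero_add]
    exact (hk k).2 (by simp)
  -- Since `L.len ≤ φ`, a full word of `L` fits before `φ` inside the prefix. It becomes the common
  -- last word.
  obtain ⟨φ, hφ0, hφ1, hφ⟩ := L.exists_isCut hx₀ L.len
  have hcut : ∀ {x i}, C x i → L.IsCut x (i + φ) := by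
    intro x i hi
    refine isCut_of_window_eq hφ fun r hr0 hr1 => ?_
    have := hpre hC₀ hi (φ + r) (by omega) (by omega)
    rw [← add_assoc, zero_add] at this
    rw [this, add_assoc]
  have hCadd : ∀ {x}, x ∈ X.carrier → ∀ {i}, C x i → C x (i + ℓ) := fun hx _ hi =>
    (hCiff _ hx _ _ hi).2 (by simp)
  obtain ⟨q, hq⟩ : L.len ∣ ℓ := by
    have := ((hcut hC₀).iff_dvd hx₀).1 (hcut (hCadd hx₀ hC₀))
    exact Int.natCast_dvd_natCast.1 (by simpa using this)
  let W : Set (List ℤ) := {w | ∃ x ∈ X.carrier, ∃ i, C x i ∧ w = window x (i + φ) ℓ}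
  -- The block that follows starts with the same `φ` letters, so a moved block is a cyclic rotation
  -- of `u` or `v`.
  have hWsub : W ⊆ {u.drop φ.toNat ++ u.take φ.toNat, v.drop φ.toNat ++ v.take φ.toNat} := by
    rintro _ ⟨x, hx, i, hi, rfl⟩
    have hw : window x (i + φ) ℓ =
        (window x i ℓ).drop φ.toNat ++ (window x i ℓ).take φ.toNat := by
      rw [take_window x i (by omega)]
      refine List.ext_getElem (by simp; omega) fun r h1 h2 => ?_
      rw [length_window] at h1
      rw [List.getElem_append]
      split_ifs with h
      · simp only [List.getElem_drop, getElem_window]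
        congr 1; push_cast; omega
      · simp only [List.length_drop, length_window] at h ⊢
        simp only [getElem_window]
        rw [← hpre (hCadd hx hi) hi (r - (ℓ - φ.toNat) : ℕ) (by omega) (by omega)]
        congr 1; omega
    rw [hw]
    rcases hi with hi | hi <;> simp [hi]
  have hCW : ∀ x ∈ X.carrier, ∀ i, (window x i ℓ ∈ W ∧ window x (i + ℓ) ℓ ∈ W) ↔
      C x (i - φ) := by
    intro x hx i
    constructor
    · rintro ⟨⟨y, hy, j, hj, h1⟩, z, hz, k, hk, h2⟩
      rw [window_eq_iff] at h1 h2
      -- The first word ends with the first `φ` letters of the common prefix, and the second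
      -- supplies the remaining letters of the original block. This is why cuts are detected by two
      -- consecutive words.
      have hw : window x (i + ℓ - φ) ℓ = window z k ℓ := window_eq_iff.2 fun r hr0 hr1 => by
        by_cases hr : r < φ
        · have e1 := h1 (ℓ - φ + r) (by omega) (by omega)
          have e2 := hpre (hCadd hy hj) hk r hr0 (by omega)
          rw [← e2, show i + ℓ - φ + r = i + (ℓ - φ + r) by ring, e1]
          congr 1; ring
        · have e2 := h2 (r - φ) (by omega) (by omega)
          rw [show i + ℓ - φ + r = i + ℓ + (r - φ) by ring, e2]
          congr 1; ring
      have : C x (i + ℓ - φ) := by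
        simp only [C, hw]
        exact hk
      exact (hCiff x hx _ _ this).2 ⟨-1, by ring⟩
    · intro h
      refine ⟨⟨x, hx, _, h, by simp⟩, x, hx, _, hCadd hx h, ?_⟩
      congr 1; ring
  have hℓpos : 0 < ℓ := by omega
  let L' : Level X :=
    { len := ℓ
      len_pos := hℓpos
      words := W
      finite := (Set.toFinite _).subset hWsub
      occurs := by
        rintro _ ⟨x, hx, i, hi, rfl⟩
        refine ⟨shiftBy (i + φ) x, X.shiftBy_mem _ x hx, by rw [window_shiftBy, zero_add],
          x, hx, i + ℓ, hCadd hx hi, ?_⟩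
        rw [window_shiftBy]
        congr 1; ring
      sync := by
        intro x hx
        obtain ⟨k, hk⟩ := hsync x hx
        refine ⟨k + φ, fun i => ?_⟩
        rw [hCW x hx, hk]
        ring_nf }
  refine ⟨L', ⟨show 2 * L.len ≤ ℓ by omega, ?_⟩,
    (Set.encard_le_encard hWsub).trans ?_⟩
  swap
  · refine (Set.encard_insert_le _ _).trans ?_
    rw [Set.encard_singleton, one_add_one_eq_two]
  have hcutmul : ∀ {x}, x ∈ X.carrier → ∀ {i}, C x i → ∀ t : ℤ, L.IsCut x (i + φ + t * L.len) :=
    fun hx i hi t => ((hcut hi).iff_dvd hx).2 (by simp)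
  have hcutpred : ∀ {x}, x ∈ X.carrier → ∀ {i}, C x i → L.IsCut x (i + φ - L.len) :=
    fun hx i hi => by simpa [sub_eq_add_neg] using hcutmul hx hi (-1)
  have hq2 : 2 ≤ q := by
    have : 2 * L.len ≤ L.len * q := by omega
    nlinarith
  refine ⟨⟨window x₀ (0 + φ) L.len, (hcut hC₀).1⟩,
    ⟨window x₀ (0 + φ - L.len) L.len, (hcutpred hx₀ hC₀).1⟩, ?_⟩
  rintro _ ⟨x, hx, i, hi, rfl⟩
  refine ⟨(List.range q).map fun t : ℕ =>
    ⟨window x (i + φ + t * L.len) L.len, (hcutmul hx hi t).1⟩, ?_, ?_, ?_, ?_⟩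
  · rw [flat, List.map_map]
    conv_rhs => rw [hq, mul_comm, ← flatten_windows]
    rfl
  · obtain ⟨q, rfl⟩ := Nat.exists_eq_succ_of_ne_zero (show q ≠ 0 by omega)
    rw [List.range_succ_eq_map]
    simp only [List.map_cons, List.head?_cons, Option.some.injEq, Subtype.mk.injEq]
    refine window_eq_iff.2 fun r hr0 hr1 => ?_
    have := hpre hi hC₀ (φ + r) (by omega) (by omega)
    rw [← add_assoc, ← add_assoc] at this
    simpa using this
  · obtain ⟨q, rfl⟩ := Nat.exists_eq_succ_of_ne_zero (show q ≠ 0 by omega)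
    rw [List.range_succ]
    simp only [List.map_append, List.map_cons, List.map_nil, List.getLast?_append,
      List.getLast?_singleton, Option.some_or, Option.some.injEq, Subtype.mk.injEq]
    refine window_eq_iff.2 fun r hr0 hr1 => ?_
    have := hpre (hCadd hx hi) hC₀ (φ - L.len + r) (by omega) (by omega)
    rw [show i + φ + q * L.len + r = i + ℓ + (φ - L.len + r) by rw [hq]; push_cast; ring, this]
    congr 1; ring
  · rintro ⟨w, hw⟩
    -- An occurrence of `w` together with a following word of `L` is a cut, so it is aligned with
    -- the factorization of the block.
    obtain ⟨y, hy, rfl, hy'⟩ := L.occurs w hw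
    obtain ⟨s, hs0, hs1, hs⟩ := hM _ (X.shiftBy_mem (i + φ) x hx) _
      (Subshift.window_mem_lang hy 0 (2 * L.len))
    rw [window_shiftBy] at hs
    have hycut : L.IsCut y 0 := ⟨hw, by simpa using hy'⟩
    rw [window_eq_iff] at hs
    have hxcut : L.IsCut x (s + (i + φ)) := isCut_of_window_eq hycut fun r hr0 hr1 =>
      (hs r hr0 (by push_cast; omega)).symm
    obtain ⟨t, ht⟩ := ((hcut hi).iff_dvd hx).1 hxcut
    have ht' : s = L.len * t := by rw [← ht]; ring
    have ht0 : 0 ≤ t := by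
      by_contra! hneg
      nlinarith
    have htq : t < q := by
      by_contra! hle
      have : (ℓ : ℤ) ≤ s := by
        rw [ht', hq]; push_cast
        exact mul_le_mul_of_nonneg_left hle (by omega)
      omega
    refine List.mem_map.2 ⟨t.toNat, List.mem_range.2 (by omega), Subtype.ext ?_⟩
    refine window_eq_iff.2 fun r hr0 hr1 => ?_
    rw [← hs r hr0 (by push_cast; omega)]
    congr 1
    rw [Int.toNat_of_nonneg ht0, ht']
    ring

/-! ### Concatenating the words of a level -/

@[simp] theorem flat_nil (L : Level X) : L.flat [] = [] := rfl

@[simp] theorem flat_cons (L : Level X) (a : L.words) (l : List L.words) :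
    L.flat (a :: l) = a.1 ++ L.flat l := rfl

@[simp] theorem flat_append (L : Level X) (l l' : List L.words) :
    L.flat (l ++ l') = L.flat l ++ L.flat l' := by
  simp [flat]

/-- The bi-infinite concatenation of a bi-infinite sequence of words of the same level. -/
def unroll (L : Level X) (y : ℤ → L.words) : ℤ → ℤ :=
  -- The default `0` is never used: the words have length `L.len`.
  fun i => (y (i / L.len)).1.getD (i % L.len).toNat 0

theorem window_unroll_mul (L : Level X) (y : ℤ → L.words) (j : ℤ) :
    window (L.unroll y) (j * L.len) L.len = y j := by
  have hl := L.length_eq (y j).2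
  have hpos := L.len_pos
  refine List.ext_getElem (by simp [hl]) fun r h1 h2 => ?_
  rw [hl] at h2
  have hd : (j * L.len + r) / L.len = j := by
    rw [add_comm, Int.add_mul_ediv_right _ _ (by omega), Int.ediv_eq_zero_of_lt] <;> omega
  have hm : (j * L.len + r) % L.len = r := by
    rw [add_comm, Int.add_mul_emod_self_right, Int.emod_eq_of_lt] <;> omega
  simp [unroll, hd, hm, hl, h2]

theorem window_unroll (L : Level X) (y : ℤ → L.words) (j : ℤ) (m : ℕ) :
    window (L.unroll y) (j * L.len) (m * L.len) = L.flat (window y j m) := by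
  induction m with
  | zero => simp [window]
  | succ m ih =>
    have h1 : window y (j + m) 1 = [y (j + m)] := by simp [window]
    rw [add_mul, one_mul, window_add, ih, window_add y, h1, flat_append, flat_cons,
      flat_nil, List.append_nil]
    rw [← window_unroll_mul, add_mul]
    push_cast
    rfl

theorem unroll_injective (L : Level X) : Function.Injective L.unroll := fun y y' h => by
  funext j
  rw [Subtype.ext_iff, ← window_unroll_mul, h, window_unroll_mul]

theorem eq_of_window_mul_eq {ℓ : ℕ} (hℓ : 0 < ℓ) {x y : ℤ → ℤ}
    (h : ∀ j : ℤ, window x (j * ℓ) ℓ = window y (j * ℓ) ℓ) : x = y := by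
  funext i
  have := window_eq_iff.1 (h (i / ℓ)) (i % ℓ) (Int.emod_nonneg _ (by omega))
    (Int.emod_lt_of_pos _ (by omega))
  rwa [mul_comm, Int.mul_ediv_add_emod] at this

theorem unroll_shiftBy (L : Level X) (y : ℤ → L.words) (k : ℤ) :
    L.unroll (shiftBy k y) = shiftBy (k * L.len) (L.unroll y) := by
  refine eq_of_window_mul_eq L.len_pos fun j => ?_
  rw [window_unroll_mul, window_shiftBy, ← add_mul, window_unroll_mul]
  rfl

theorem isCut_unroll (L : Level X) (y : ℤ → L.words) : L.IsCut (L.unroll y) 0 := by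
  have h0 := window_unroll_mul L y 0
  have h1 := window_unroll_mul L y 1
  rw [zero_mul] at h0
  rw [one_mul] at h1
  rw [IsCut, zero_add, h0, h1]
  exact ⟨(y 0).2, (y 1).2⟩

theorem length_flat (L : Level X) (l : List L.words) : (L.flat l).length = l.length * L.len := by
  induction l with
  | nil => simp [flat]
  | cons a l ih =>
    rw [flat_cons, List.length_append, ih, L.length_eq a.2, List.length_cons]
    ring

theorem flat_injective (L : Level X) : Function.Injective L.flat := by
  intro l l' h
  have hlen : l.length = l'.length := by
    have := congrArg List.length h
    simp only [length_flat] at this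
    exact Nat.eq_of_mul_eq_mul_right L.len_pos this
  refine List.map_injective_iff.2 Subtype.val_injective (List.eq_iff_flatten_eq.2 ⟨h, ?_⟩)
  have : ∀ l : List L.words, (l.map Subtype.val).map List.length = List.replicate l.length L.len :=
    fun l => by
      rw [List.map_map, List.eq_replicate_iff]
      refine ⟨by simp, fun b hb => ?_⟩
      obtain ⟨a, -, rfl⟩ := List.mem_map.1 hb
      exact L.length_eq a.2
  rw [this, this, hlen]

theorem nonempty_words (L : Level X) (hne : X.carrier.Nonempty) : L.words.Nonempty := by
  obtain ⟨x, hx⟩ := hne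
  obtain ⟨i, -, -, hi⟩ := L.exists_isCut hx 0
  exact ⟨_, hi.1⟩

/-! ### The directive sequence of a sequence of refining levels -/

section Directive

variable (L : ℕ → Level X) (hL : ∀ n, (L (n + 1)).Refines (L n)) (hne : X.carrier.Nonempty)

/-- The morphisms that factorize the words of each level into words of the previous level. -/
noncomputable def directive : DirectiveSequence where
  A n := (L n).words
  finite n := (L n).finite
  nonempty n := ((L n).nonempty_words hne).to_subtype
  τ n a := ((hL n).exists_factorization.choose_spec.choose_spec a.1 a.2).choose
  nonerasing n a h := by
    have := ((hL n).exists_factorization.choose_spec.choose_spec a.1 a.2).choose_spec.2.1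
    rw [h] at this
    simp at this

theorem flat_directive_τ (n : ℕ) (a : (L (n + 1)).words) :
    (L n).flat ((directive L hL hne).τ n a) = a :=
  ((hL n).exists_factorization.choose_spec.choose_spec a.1 a.2).choose_spec.1

theorem mem_directive_τ (n : ℕ) (a : (L (n + 1)).words) (b : (L n).words) :
    b ∈ (directive L hL hne).τ n a :=
  ((hL n).exists_factorization.choose_spec.choose_spec a.1 a.2).choose_spec.2.2.2 b

theorem isProper_directive : (directive L hL hne).IsProper := fun n =>
  ⟨_, _, fun a =>
    have h := ((hL n).exists_factorization.choose_spec.choose_spec a.1 a.2).choose_spec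
    ⟨h.2.1, h.2.2.1⟩⟩

theorem isPrimitive_directive : (directive L hL hne).IsPrimitive := fun n =>
  ⟨1, one_pos, fun a b => List.mem_flatMap.2
    ⟨b, mem_directive_τ L hL hne n a b, List.mem_singleton_self b⟩⟩

theorem length_directive_τ_mul (n : ℕ) (a : (L (n + 1)).words) :
    ((directive L hL hne).τ n a).length * (L n).len = (L (n + 1)).len := by
  rw [← (L (n + 1)).length_eq a.2, ← flat_directive_τ L hL hne n a]
  exact ((L n).length_flat _).symm

theorem isConstantLength_directive : (directive L hL hne).IsConstantLength := fun n =>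
  ⟨(L (n + 1)).len / (L n).len, fun a => by
    rw [← length_directive_τ_mul L hL hne n a]
    exact (Nat.mul_div_cancel _ (L n).len_pos).symm⟩

theorem flat_directive_comp (n k : ℕ) (a : (L (n + k)).words) :
    (L n).flat ((directive L hL hne).comp n k a) = a := by
  induction k with
  | zero => exact List.append_nil _
  | succ k ih =>
    have h : ∀ l : List (L (n + k)).words,
        (L n).flat (l.flatMap ((directive L hL hne).comp n k)) = (L (n + k)).flat l := fun l => by
      induction l with
      | nil => rfl
      | cons b l ihl =>
        exact ((L n).flat_append ((directive L hL hne).comp n k b) _).trans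
          (congrArg₂ (· ++ ·) (ih b) ihl)
    exact (h _).trans (flat_directive_τ L hL hne (n + k) a)

/-- A finite subword of `y` lies in some `τ_{[n, n+k)}(a)`, which spells the level word `a`, and `a`
occurs in `X`. Closedness of `X` does the rest. -/
theorem unroll_mem {n : ℕ} {y : ℤ → (L n).words} (hy : y ∈ (directive L hL hne).subshift n) :
    (L n).unroll y ∈ X.carrier := by
  refine Subshift.mem_of_window_mem fun m => ?_
  have hpos := (L n).len_pos
  obtain ⟨w, ⟨k, -, a, hwa⟩, hw⟩ := hy (-m) (2 * m)
  have h1 : window y (-m) (2 * m) <:+: (directive L hL hne).comp n k a := hw.trans hwa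
  have h2 : (L n).flat (window y (-m) (2 * m)) <:+: a.1 := by
    rw [← flat_directive_comp L hL hne n k a]
    obtain ⟨s, t, h⟩ := h1
    rw [← h]
    exact ⟨(L n).flat s, (L n).flat t, by simp⟩
  rw [← window_unroll] at h2
  obtain ⟨x, hx, hxa, -⟩ := (L (n + k)).occurs a.1 a.2
  rw [← hxa] at h2
  have hle : (m : ℤ) ≤ m * (L n).len := by nlinarith
  have h3 : window ((L n).unroll y) (-m) (2 * m) <:+:
      window ((L n).unroll y) (-m * (L n).len) (2 * m * (L n).len) :=
    window_isInfix_window _ (by linarith) (by push_cast; linarith)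
  obtain ⟨j, -, -, hj⟩ := exists_eq_window_of_isInfix (h3.trans h2)
  rw [length_window] at hj
  rw [hj]
  exact Subshift.window_mem_lang hx _ _

theorem unroll_of_isImage {n : ℕ} {y : ℤ → (L (n + 1)).words} {z : ℤ → (L n).words}
    (h : IsImage ((directive L hL hne).τ n) y z) : (L n).unroll z = (L (n + 1)).unroll y := by
  obtain ⟨c, hc0, hc⟩ := h
  have hlen := fun j => length_directive_τ_mul L hL hne n (y j)
  have hcmul : ∀ i : ℤ, c i * (L n).len = i * (L (n + 1)).len := fun i => by
    induction i using Int.induction_on with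
    | zero => simp [hc0]
    | succ i ih =>
      rw [(hc i).1, add_mul, ih, ← hlen i]
      push_cast; ring
    | pred i ih =>
      have h1 := (hc (-i - 1)).1
      rw [sub_add_cancel] at h1
      rw [h1, add_mul] at ih
      have h2 : (((directive L hL hne).τ n (y (-i - 1))).length : ℤ) * (L n).len =
        (L (n + 1)).len := by exact_mod_cast hlen (-i - 1)
      linarith
  refine eq_of_window_mul_eq (L (n + 1)).len_pos fun j => ?_
  rw [window_unroll_mul, ← hcmul, ← hlen j, window_unroll]
  exact (congrArg (L n).flat (hc j).2).trans
    (flat_directive_τ L hL hne n (y j))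

/-- Two representations of `x` spell points of `X` that differ by a shift by `(k - k') * (L n).len`.
Both have a cut of level `n + 1` at `0`, so the length of the images under `τ_n` divides `k - k'`,
which is smaller in absolute value. -/
theorem isRecognizable_directive : (directive L hL hne).IsRecognizable := by
  rintro n x y y' k k' hy hy' ⟨⟨z, hz, rfl⟩, hk0, hk1⟩ ⟨⟨z', hz', hzz'⟩, hk0', hk1'⟩
  have hu := unroll_of_isImage L hL hne hz
  have hu' := unroll_of_isImage L hL hne hz'
  have hX := unroll_mem L hL hne hy
  have hlen := length_directive_τ_mul L hL hne n (y 0)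
  have hlen' := length_directive_τ_mul L hL hne n (y' 0)
  have hpos := (L n).len_pos
  rw [← Nat.eq_of_mul_eq_mul_right hpos (hlen.trans hlen'.symm)] at hk1'
  have he := ((L n).unroll_shiftBy z k).symm.trans
    ((congrArg (L n).unroll hzz').trans ((L n).unroll_shiftBy z' k'))
  rw [hu, hu'] at he
  have he' : (L (n + 1)).unroll y' = shiftBy ((k - k') * (L n).len) ((L (n + 1)).unroll y) := by
    have := congrArg (shiftBy (-(k' * (L n).len))) he
    rw [shiftBy_shiftBy, shiftBy_shiftBy, neg_add_cancel, shiftBy_zero] at this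
    rw [← this]; congr 1; ring
  have hcut := (L (n + 1)).isCut_unroll y'
  rw [he', isCut_shiftBy, ((L (n + 1)).isCut_unroll y).iff_dvd hX, ← hlen] at hcut
  simp only [zero_add, sub_zero] at hcut
  push_cast at hcut
  have hdvd := Int.dvd_of_mul_dvd_mul_right (by omega) hcut
  have hkk : k = k' := by
    have := Int.eq_zero_of_abs_lt_dvd hdvd 
      (abs_lt.2 ⟨by linarith, by linarith⟩)
    omega
  subst hkk
  rw [sub_self, zero_mul, shiftBy_zero] at he'
  exact ⟨((L (n + 1)).unroll_injective he').symm, rfl⟩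

theorem le_len (L : ℕ → Level X) (hL : ∀ n, (L (n + 1)).Refines (L n)) (n : ℕ) :
    n ≤ (L n).len := by
  induction n with
  | zero => exact Nat.zero_le _
  | succ n ih =>
    have := (hL n).two_mul_len_le
    have := (L n).len_pos
    omega

theorem conjugate_directive (h0 : L 0 = letters X) (hmin : X.IsMinimal) :
    Conjugate X.carrier ((directive L hL hne).subshift 0) := by
  have hlen : (L 0).len = 1 := by rw [h0]; rfl
  have hwords : (L 0).words = X.lang 1 := by rw [h0]; rfl
  have hwin : ∀ x ∈ X.carrier, ∀ i, window x i 1 ∈ (L 0).words := fun x hx i => by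
    rw [hwords]; exact Subshift.window_mem_lang hx i 1
  let f : X.carrier → ℤ → (L 0).words := fun x i => ⟨window x.1 i 1, hwin x.1 x.2 i⟩
  have hf : ∀ x, (L 0).unroll (f x) = x.1 := fun x => by
    refine eq_of_window_mul_eq (L 0).len_pos fun j => ?_
    rw [window_unroll_mul, hlen]
    simp [f]
  have hfmem : ∀ x, f x ∈ (directive L hL hne).subshift 0 := by
    intro x i m
    obtain ⟨M, hM⟩ := hmin.exists_recurrentWithin m
    -- Level lengths grow at least like the index, so a word of this level has room for every word
    -- of length `m` of `X`.
    obtain ⟨a, ha⟩ := (L (0 + (M + m + 1))).nonempty_words hne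
    refine ⟨(directive L hL hne).comp 0 (M + m + 1) ⟨a, ha⟩, ⟨_, Nat.succ_pos _, _,
      List.infix_rfl⟩, ?_⟩
    obtain ⟨y, hy, hya, -⟩ := (L (0 + (M + m + 1))).occurs a ha
    have hcomp : (directive L hL hne).comp 0 (M + m + 1) ⟨a, ha⟩ =
        window (f ⟨y, hy⟩) 0 (L (0 + (M + m + 1))).len := by
      refine (L 0).flat_injective ?_
      refine (flat_directive_comp L hL hne 0 _ ⟨a, ha⟩).trans ?_
      rw [← window_unroll, hf, hlen]
      simpa using hya.symm
    obtain ⟨j, hj0, hj1, hj⟩ := hM y hy _ (Subshift.window_mem_lang x.2 i m)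
    have hle := le_len L hL (0 + (M + m + 1))
    have : window (f x) i m = window (f ⟨y, hy⟩) j m := by
      refine (L 0).flat_injective ?_
      have h1 := window_unroll (L 0) (f x) i m
      have h2 := window_unroll (L 0) (f ⟨y, hy⟩) j m
      rw [hf, hlen] at h1 h2
      rw [← h1, ← h2]
      simpa using hj.symm
    have hinf := window_isInfix_window (f ⟨y, hy⟩) (i := 0) (m := m)
      (n := (L (0 + (M + m + 1))).len) hj0 (by omega)
    rw [← this] at hinf
    rw [hcomp]
    exact hinf
  have hcont : Continuous fun x : X.carrier =>
      (⟨f x, hfmem x⟩ : (directive L hL hne).subshift 0) := by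
    refine Continuous.subtype_mk (continuous_pi fun i => ?_) _
    refine (IsLocallyConstant.iff_exists_open _).2 (fun x => ?_) |>.continuous
    refine ⟨{y | window y.1 i 1 ∈ ({window x.1 i 1} : Set _)},
      (isClopen_setOf_window_mem i 1 _).isOpen.preimage continuous_subtype_val, rfl, fun y hy => ?_⟩
    exact Subtype.ext hy
  have : CompactSpace X.carrier := isCompact_iff_compactSpace.1 X.isCompact
  let e : X.carrier ≃ (directive L hL hne).subshift 0 :=
    { toFun := fun x => ⟨f x, hfmem x⟩
      invFun := fun y => ⟨(L 0).unroll y.1, unroll_mem L hL hne y.2⟩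
      left_inv := fun x => Subtype.ext (hf x)
      right_inv := fun y => Subtype.ext ((L 0).unroll_injective (hf _)) }
  refine ⟨hcont.homeoOfEquivCompactToT2 (f := e), fun x x' hxx' => ?_⟩
  funext i
  refine Subtype.ext ?_
  show window x'.1 i 1 = window x.1 (i + 1) 1
  rw [hxx', shift, window_shiftBy]

/-- Level `0` may have more than two letters, but the lower limit ignores it. -/
theorem alphabetRank_directive_le (hcard : ∀ n, (L (n + 1)).words.encard ≤ 2) :
    (directive L hL hne).alphabetRank ≤ 2 := by
  refine liminf_le_of_frequently_le' (Eventually.frequently ?_)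
  filter_upwards [eventually_ge_atTop 1] with n hn
  obtain ⟨n, rfl⟩ := Nat.exists_eq_succ_of_ne_zero (show n ≠ 0 by omega)
  refine le_trans (le_of_eq ?_) (hcard n)
  exact (L (n + 1)).finite.cast_ncard_eq

end Directive

end Level

theorem isStrongToeplitz_two {X : Subshift} (hmin : X.IsMinimal) (hne : X.carrier.Nonempty)
    (hX : ∀ n, 0 < n → X.HasMarkedBlocks n) : IsStrongToeplitz 2 X := by
  choose next hnext hcard using Level.exists_refines hmin hne hX
  let L : ℕ → Level X := fun n => next^[n] (Level.letters X)
  have hsucc : ∀ n, L (n + 1) = next (L n) := fun n => Function.iterate_succ_apply' next n _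
  have hL : ∀ n, (L (n + 1)).Refines (L n) := fun n => by rw [hsucc]; exact hnext _
  exact ⟨Level.directive L hL hne, Level.isConstantLength_directive L hL hne,
    Level.isPrimitive_directive L hL hne, Level.isProper_directive L hL hne,
    Level.isRecognizable_directive L hL hne,
    Level.alphabetRank_directive_le L hL hne fun n => by rw [hsucc]; exact hcard _,
    Level.conjugate_directive L hL hne rfl hmin⟩

/-! ### Substitutions of constant length -/

/-- The image of `x` under the substitution `a ↦ f a 0, …, f a (ℓ - 1)`. -/
def subst (ℓ : ℕ) (f : ℤ → ℤ → ℤ) (x : ℤ → ℤ) : ℤ → ℤ := fun i => f (x (i / ℓ)) (i % ℓ)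

section Subst

variable {ℓ : ℕ} {f : ℤ → ℤ → ℤ}

theorem subst_mul_add (x : ℤ → ℤ) (j : ℤ) {r : ℤ} (h0 : 0 ≤ r) (h1 : r < ℓ) :
    subst ℓ f x (ℓ * j + r) = f (x j) r := by
  have hd : (ℓ * j + r) / ℓ = j := by
    rw [add_comm, Int.add_mul_ediv_left _ _ (by omega), Int.ediv_eq_zero_of_lt h0 h1, zero_add]
  have hm : (ℓ * j + r) % ℓ = r := by
    rw [add_comm, Int.add_mul_emod_self_left, Int.emod_eq_of_lt h0 h1]
  rw [subst, hd, hm]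

theorem exists_eq_mul_add (hℓ : 0 < ℓ) (i : ℤ) : ∃ j r : ℤ, 0 ≤ r ∧ r < ℓ ∧ i = ℓ * j + r :=
  ⟨i / ℓ, i % ℓ, Int.emod_nonneg _ (by omega), Int.emod_lt_of_pos _ (by omega),
    (Int.mul_ediv_add_emod i ℓ).symm⟩

theorem subst_shiftBy (hℓ : 0 < ℓ) (x : ℤ → ℤ) (k : ℤ) :
    subst ℓ f (shiftBy k x) = shiftBy (ℓ * k) (subst ℓ f x) := by
  funext i
  obtain ⟨j, r, h0, h1, rfl⟩ := exists_eq_mul_add hℓ i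
  rw [subst_mul_add _ _ h0 h1, shiftBy, shiftBy,
    show ℓ * j + r + ℓ * k = ℓ * (j + k) + r by ring, subst_mul_add _ _ h0 h1]

theorem continuous_subst : Continuous (subst ℓ f) :=
  continuous_pi fun i =>
    (continuous_of_discreteTopology (f := fun a => f a (i % ℓ))).comp (continuous_apply (i / ℓ))

/-- The subshift generated by the images of the points of `X` under a substitution. -/
def Subshift.subst (X : Subshift) (ℓ : ℕ) (hℓ : 0 < ℓ) (f : ℤ → ℤ → ℤ) : Subshift :=
  ofInvariant {y | ∃ x ∈ X.carrier, ∃ k, y = shiftBy k (StrongToeplitz.subst ℓ f x)}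
    (by
      obtain ⟨A, hA⟩ := X.finite_alphabet
      refine ⟨(A ×ˢ Finset.Ico (0 : ℤ) ℓ).image fun q => f q.1 q.2, ?_⟩
      rintro _ ⟨x, hx, k, rfl⟩ i
      refine Finset.mem_image.2 ⟨(x ((i + k) / ℓ), (i + k) % ℓ), ?_, rfl⟩
      exact Finset.mem_product.2 ⟨hA x hx _, Finset.mem_Ico.2
        ⟨Int.emod_nonneg _ (by omega), Int.emod_lt_of_pos _ (by omega)⟩⟩)
    (by
      have : {y | ∃ x ∈ X.carrier, ∃ k, y = shiftBy k (StrongToeplitz.subst ℓ f x)} =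
          ⋃ k ∈ Finset.Ico (0 : ℤ) ℓ,
            (fun x => shiftBy k (StrongToeplitz.subst ℓ f x)) '' X.carrier := by
        ext y
        simp only [Set.mem_iUnion, Set.mem_image, Finset.mem_Ico]
        constructor
        · rintro ⟨x, hx, k, rfl⟩
          obtain ⟨j, r, h0, h1, rfl⟩ := exists_eq_mul_add hℓ k
          refine ⟨r, ⟨h0, h1⟩, shiftBy j x, X.shiftBy_mem j x hx, ?_⟩
          rw [subst_shiftBy hℓ, shiftBy_shiftBy, add_comm]
        · rintro ⟨k, -, x, hx, rfl⟩
          exact ⟨x, hx, k, rfl⟩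
      rw [this]
      exact (Finset.isCompact_biUnion _ fun k _ =>
        X.isCompact.image ((continuous_shiftBy k).comp continuous_subst)).isClosed)
    (by
      rintro k _ ⟨x, hx, j, rfl⟩
      exact ⟨x, hx, k + j, shiftBy_shiftBy _ _ _⟩)

theorem Subshift.IsMinimal.subst {X : Subshift} (hX : X.IsMinimal) (hℓ : 0 < ℓ) :
    (X.subst ℓ hℓ f).IsMinimal := by
  rintro _ ⟨x, hx, k, rfl⟩ _ ⟨x', hx', k', rfl⟩
  have hcont : Continuous fun z => shiftBy k' (StrongToeplitz.subst ℓ f z) :=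
    (continuous_shiftBy k').comp continuous_subst
  refine closure_mono ?_ (image_closure_subset_closure_image hcont
    (Set.mem_image_of_mem _ (hX x hx hx')))
  rintro _ ⟨_, ⟨j, rfl⟩, rfl⟩
  refine ⟨k' + ℓ * j - k, ?_⟩
  simp only [subst_shiftBy hℓ, shiftBy_shiftBy]
  congr 1; ring

/-- A period `p` of the image yields the period `ℓ * p`, which carries each block to the block `p`
places further on. -/
theorem Subshift.eq_of_forall_subst_eq {X : Subshift} {hℓ : 0 < ℓ} {p : ℕ}
    (h : ∀ y ∈ (X.subst ℓ hℓ f).carrier, y 0 = y p) {x : ℤ → ℤ} (hx : x ∈ X.carrier) {r : ℤ}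
    (h0 : 0 ≤ r) (h1 : r < ℓ) : f (x 0) r = f (x p) r := by
  have hper : ∀ i, StrongToeplitz.subst ℓ f x i = StrongToeplitz.subst ℓ f x (i + p) := by
    intro i
    have := h _ ⟨x, hx, i, rfl⟩
    simpa [shiftBy, add_comm] using this
  have hmul : ∀ t : ℕ, StrongToeplitz.subst ℓ f x r = StrongToeplitz.subst ℓ f x (r + p * t) := by
    intro t
    induction t with
    | zero => simp
    | succ t ih =>
      rw [ih, hper]
      congr 1; push_cast; ring
  have := hmul ℓ
  rw [show r + (p : ℤ) * ℓ = ℓ * p + r by ring, subst_mul_add x p h0 h1] at this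
  rw [← this]
  conv_rhs => rw [show r = ℓ * 0 + r by ring, subst_mul_add x 0 h0 h1]

end Subst

theorem Subshift.IsAperiodic.nonempty {X : Subshift} (h : X.IsAperiodic) : X.carrier.Nonempty := by
  obtain ⟨x, hx, -⟩ := h 1 one_pos
  exact ⟨x, hx⟩

/-- Otherwise each letter `a` has some `p a` that preserves its occurrences, and the product of the
`p a` is a common period. Such a letter allows a binary coding that stays aperiodic. -/
theorem Subshift.IsAperiodic.exists_letter {X : Subshift} (h : X.IsAperiodic) :
    ∃ a : ℤ, ∀ p : ℕ, 0 < p → ∃ x ∈ X.carrier, ¬ (x 0 = a ↔ x p = a) := by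
  by_contra! hcon
  choose p hp0 hp using hcon
  obtain ⟨A, hA⟩ := X.finite_alphabet
  obtain ⟨x, hx, hne⟩ := h (∏ a ∈ A, p a) (Finset.prod_pos fun a _ => hp0 a)
  obtain ⟨q, hq⟩ := Finset.dvd_prod_of_mem p (hA x hx 0)
  have : ∀ t : ℕ, x (p (x 0) * t : ℕ) = x 0 := fun t => by
    induction t with
    | zero => simp
    | succ t ih =>
      have := hp (x 0) _ (X.shiftBy_mem (p (x 0) * t : ℕ) x hx)
      simp only [shiftBy, zero_add] at this
      refine Eq.trans ?_ (this.1 ih)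
      congr 1; push_cast; ring
  exact hne (by rw [hq, this])

/-! ### Two synchronizing words -/

/-- The binary word whose zeros are at the positions `0`, `1` and `e`. -/
def markedWord (e r : ℤ) : ℤ := if r = 0 ∨ r = 1 ∨ r = e then 0 else 1

theorem markedWord_eq (e r : ℤ) : markedWord e r = 0 ∨ markedWord e r = 1 := by
  unfold markedWord; split_ifs <;> simp

/-- The substitution by marked words of length `Q`: the letter `a` is distinguished from all other
letters. -/
def markedSubst (Q : ℕ) (a b r : ℤ) : ℤ := markedWord (if b = a then (Q : ℤ) - 3 else Q - 2) r

theorem subst_markedSubst_eq (Q : ℕ) (a : ℤ) (x : ℤ → ℤ) (i : ℤ) :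
    subst Q (markedSubst Q a) x i = 0 ∨ subst Q (markedSubst Q a) x i = 1 := markedWord_eq _ _

/-- The third zero is isolated: it lies at `Q - 3 ≥ 3` or `Q - 2`, and the last letter is `1`. So
`00` occurs only at the start of a marked word. -/
theorem dvd_of_subst_markedSubst_eq_zero {Q : ℕ} (hQ : 6 ≤ Q) {a : ℤ} {x : ℤ → ℤ} {m : ℤ}
    (h0 : subst Q (markedSubst Q a) x m = 0) (h1 : subst Q (markedSubst Q a) x (m + 1) = 0) :
    (Q : ℤ) ∣ m := by
  obtain ⟨j, r, hr0, hr1, rfl⟩ := exists_eq_mul_add (show 0 < Q by omega) m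
  rw [subst_mul_add _ _ hr0 hr1, markedSubst, markedWord] at h0
  have hr : r ≠ Q - 1 := by
    rintro rfl
    split_ifs at h0 <;> omega
  rw [add_assoc, subst_mul_add _ _ (by omega) (by omega), markedSubst, markedWord] at h1
  have : r = 0 := by split_ifs at h0 h1 <;> omega
  simp [this]

/-- The substitution `0 ↦ c`, `1 ↦ d`. -/
def pairSubst (c d : ℤ → ℤ) (b r : ℤ) : ℤ := if b = 0 then c r else d r

section Pair

variable {L : ℕ} {c d : ℤ → ℤ} {δ : ℤ}

theorem pairSubst_inj (hne : c δ ≠ d δ) {b b' : ℤ} (hb : b = 0 ∨ b = 1) (hb' : b' = 0 ∨ b' = 1)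
    (h : pairSubst c d b δ = pairSubst c d b' δ) : b = b' := by
  rcases hb with rfl | rfl <;> rcases hb' with rfl | rfl <;> simp_all [pairSubst]

theorem pairSubst_ne {b b' r : ℤ} (h : pairSubst c d b r ≠ pairSubst c d b' r) :
    b ≠ b' ∧ c r ≠ d r := by
  refine ⟨by rintro rfl; exact h rfl, fun he => h ?_⟩
  simp [pairSubst, he]

/-- An occurrence of `c c d` in a concatenation of the words `c` and `d` of length `L` starts at
a cutting point, if `δ` is the first position where `c` and `d` differ. -/
theorem exists_eq_mul_of_occurrence (hδ0 : 0 ≤ δ) (hδL : δ < L) (hne : c δ ≠ d δ)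
    (hlt : ∀ r, 0 ≤ r → r < δ → c r = d r) {β : ℤ → ℤ} (hβ : ∀ j, β j = 0 ∨ β j = 1) {i : ℤ}
    (h0 : ∀ r : ℤ, 0 ≤ r → r < L → subst L (pairSubst c d) β (i + r) = c r)
    (h1 : ∀ r : ℤ, 0 ≤ r → r < L → subst L (pairSubst c d) β (i + L + r) = c r)
    (h2 : ∀ r : ℤ, 0 ≤ r → r < L → subst L (pairSubst c d) β (i + 2 * L + r) = d r) :
    ∃ m, i = L * m ∧ β m = 0 ∧ β (m + 1) = 0 := by
  set y := subst L (pairSubst c d) β with hy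
  have hblock : ∀ j r : ℤ, 0 ≤ r → r < L → y (L * j + r) = pairSubst c d (β j) r := fun j r =>
    subst_mul_add β j
  -- The stretch has period `L` until `d` departs from `c`, that is, for `L + δ` steps.
  have hper : ∀ s : ℤ, 0 ≤ s → s < L + δ → y (i + s) = y (i + s + L) := by
    intro s hs0 hs1
    by_cases hs : s < L
    · rw [h0 s hs0 hs, show i + s + L = i + L + s by ring, h1 s hs0 hs]
    · have e1 := h1 (s - L) (by omega) (by omega)
      have e2 := h2 (s - L) (by omega) (by omega)
      rw [show i + s = i + L + (s - L) by ring, e1, hlt _ (by omega) (by omega), ← e2]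
      congr 1; ring
  obtain ⟨j, r, hr0, hr1, hjr⟩ := exists_eq_mul_add (show 0 < L by omega) (i + L + δ)
  -- The period breaks at `i + L + δ`, so blocks `j` and `j + 1` are different and `r` is a position
  -- where `c` and `d` differ.
  have hchange : pairSubst c d (β j) r ≠ pairSubst c d (β (j + 1)) r := by
    rw [← hblock j r hr0 hr1, ← hblock (j + 1) r hr0 hr1, ← hjr, h1 δ hδ0 hδL,
      show (L : ℤ) * (j + 1) + r = i + 2 * L + δ by rw [mul_add]; omega, h2 δ hδ0 hδL]
    exact hne
  obtain ⟨hjj, hcr⟩ := pairSubst_ne hchange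
  have hle : δ ≤ r := by
    by_contra! hr
    exact hcr (hlt r hr0 hr)
  -- If `δ < r`, position `δ` of block `j` is still in the periodic stretch, although it
  -- distinguishes the blocks `j` and `j + 1`.
  have hrδ : r = δ := by
    by_contra hr
    have e := hper (L + δ - (r - δ)) (by omega) (by omega)
    rw [show i + (L + δ - (r - δ)) = L * j + δ by omega,
      show L * j + δ + L = L * (j + 1) + δ by ring, hblock _ _ hδ0 hδL, hblock _ _ hδ0 hδL] at e
    exact hjj (pairSubst_inj hne (hβ _) (hβ _) e)
  have hi : i = L * (j - 1) := by rw [mul_sub]; omega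
  have hzero : ∀ b : ℤ, b = 0 ∨ b = 1 → pairSubst c d b δ = c δ → b = 0 := fun b hb h =>
    pairSubst_inj hne hb (Or.inl rfl) (by rw [h]; simp [pairSubst])
  refine ⟨j - 1, hi, hzero _ (hβ _) ?_, hzero _ (hβ _) ?_⟩
  · rw [← hblock _ _ hδ0 hδL, ← hi, h0 δ hδ0 hδL]
  · rw [← hblock _ _ hδ0 hδL, mul_add, ← hi, mul_one, h1 δ hδ0 hδL]

theorem Subshift.mem_subst_subst {X : Subshift} {Q : ℕ} {hQ : 0 < Q} {hL : 0 < L}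
    {f g : ℤ → ℤ → ℤ} {y : ℤ → ℤ} (hy : y ∈ ((X.subst Q hQ f).subst L hL g).carrier) :
    ∃ x ∈ X.carrier, ∃ k,
      y = shiftBy k (StrongToeplitz.subst L g (StrongToeplitz.subst Q f x)) := by
  obtain ⟨_, ⟨x, hx, k, rfl⟩, k', rfl⟩ := hy
  exact ⟨x, hx, k' + L * k, by rw [subst_shiftBy hL, shiftBy_shiftBy]⟩

/-- The blocks are the images of the two marked words. Each begins with the image `ccd` of `001`,
which forces a cutting point of the `c`, `d` concatenation, and then `00` forces a cutting point of
the marked words. The marked words agree before `Q - 3 = n + 3`, hence so do their images on `n`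
letters. -/
theorem Subshift.hasMarkedBlocks_subst_subst (X : Subshift) (n : ℕ) (a : ℤ) (hL : 0 < L)
    (hδ0 : 0 ≤ δ) (hδL : δ < L) (hne : c δ ≠ d δ) (hlt : ∀ r, 0 ≤ r → r < δ → c r = d r) :
    ((X.subst (n + 6) (Nat.succ_pos _) (markedSubst (n + 6) a)).subst L hL
      (pairSubst c d)).HasMarkedBlocks n := by
  obtain ⟨Q, hQ⟩ : ∃ Q, Q = n + 6 := ⟨_, rfl⟩
  have hQpos : 0 < Q := by omega
  let w : ℤ → ℤ → ℤ := fun e => StrongToeplitz.subst L (pairSubst c d) (markedWord e)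
  have hw : ∀ e j r : ℤ, 0 ≤ r → r < L → w e (L * j + r) = pairSubst c d (markedWord e j) r :=
    fun e j r => subst_mul_add _ j
  have hle : n ≤ L * Q := by nlinarith
  refine ⟨L * Q, hle, window (w (Q - 3)) 0 (L * Q), window (w (Q - 2)) 0 (L * Q), ?_, ?_⟩
  · rw [take_window _ _ hle, take_window _ _ hle]
    refine window_eq_iff.2 fun R hR0 hR1 => ?_
    rw [zero_add]
    obtain ⟨j, r, hr0, hr1, rfl⟩ := exists_eq_mul_add hL R
    rw [hw _ _ _ hr0 hr1, hw _ _ _ hr0 hr1]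
    have hj : j < n := by
      by_contra! hj
      nlinarith
    have : markedWord ((Q : ℤ) - 3) j = markedWord (Q - 2) j := by
      unfold markedWord
      split_ifs <;> omega
    rw [this]
  · intro y hy
    obtain ⟨x, hx, k, rfl⟩ := mem_subst_subst hy
    rw [← hQ]
    set β := StrongToeplitz.subst Q (markedSubst Q a) x with hβ
    set y := StrongToeplitz.subst L (pairSubst c d) β with hy
    refine ⟨-k, fun i => ?_⟩
    rw [sub_neg_eq_add, window_shiftBy]
    generalize i + k = i
    constructor
    · intro h
      obtain ⟨e, he, hwin⟩ : ∃ e : ℤ, ((e = Q - 3) ∨ e = Q - 2) ∧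
          window y i (L * Q) = window (w e) 0 (L * Q) := by
        rcases h with h | h
        · exact ⟨_, Or.inl rfl, h⟩
        · exact ⟨_, Or.inr rfl, h⟩
      have hocc : ∀ j r : ℤ, 0 ≤ j → j < Q → 0 ≤ r → r < L →
          y (i + (L * j + r)) = pairSubst c d (markedWord e j) r := by
        intro j r hj0 hj1 hr0 hr1
        rw [← hw _ _ _ hr0 hr1]
        have := window_eq_iff.1 hwin (L * j + r) (by positivity) (by push_cast; nlinarith)
        rwa [zero_add] at this
      have hm0 : markedWord e 0 = 0 := by simp [markedWord]
      have hm1 : markedWord e 1 = 0 := by simp [markedWord]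
      have hm2 : markedWord e 2 = 1 := by
        unfold markedWord
        rw [if_neg (by omega)]
      obtain ⟨m, rfl, hz0, hz1⟩ := exists_eq_mul_of_occurrence hδ0 hδL hne hlt
        (subst_markedSubst_eq Q a x) (i := i)
        (fun r h0 h1 => by
          have := hocc 0 r le_rfl (by omega) h0 h1
          rw [hm0, mul_zero, zero_add] at this
          exact this.trans (by simp [pairSubst]))
        (fun r h0 h1 => by
          have := hocc 1 r (by omega) (by omega) h0 h1
          rw [hm1, mul_one, ← add_assoc] at this
          exact this.trans (by simp [pairSubst]))
        (fun r h0 h1 => by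
          have := hocc 2 r (by omega) (by omega) h0 h1
          rw [hm2, mul_comm, ← add_assoc] at this
          exact this.trans (by simp [pairSubst]))
      push_cast
      exact mul_dvd_mul_left _ (dvd_of_subst_markedSubst_eq_zero (by omega) hz0 hz1)
    · rintro ⟨t, rfl⟩
      have key : window y (((L * Q : ℕ) : ℤ) * t) (L * Q) =
          window (w (if x t = a then (Q : ℤ) - 3 else Q - 2)) 0 (L * Q) := by
        refine window_eq_iff.2 fun R hR0 hR1 => ?_
        obtain ⟨j, r, hr0, hr1, rfl⟩ := exists_eq_mul_add hL R
        push_cast at hR1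
        have hj0 : 0 ≤ j := by
          by_contra! hj
          nlinarith
        have hj1 : j < Q := by
          by_contra! hj
          nlinarith
        rw [zero_add, hw _ _ _ hr0 hr1, hy,
          show ((L * Q : ℕ) : ℤ) * t + (L * j + r) = L * (Q * t + j) + r by push_cast; ring,
          subst_mul_add _ _ hr0 hr1, hβ, subst_mul_add _ _ hj0 hj1]
        rfl
      split_ifs at key
      · exact Or.inl key
      · exact Or.inr key

theorem Subshift.IsAperiodic.subst_subst {X : Subshift} {a : ℤ}
    (ha : ∀ p : ℕ, 0 < p → ∃ x ∈ X.carrier, ¬ (x 0 = a ↔ x p = a)) {Q : ℕ} (hQ : 6 ≤ Q)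
    {hQ0 : 0 < Q} {hL : 0 < L} (hδ0 : 0 ≤ δ) (hδL : δ < L) (hne : c δ ≠ d δ) :
    ((X.subst Q hQ0 (markedSubst Q a)).subst L hL (pairSubst c d)).IsAperiodic := by
  intro p hp
  by_contra! hcon
  obtain ⟨x, hx, hxa⟩ := ha p hp
  have hZ : ∀ z ∈ (X.subst Q hQ0 (markedSubst Q a)).carrier, z 0 = z p := by
    intro z hz
    have h01 : ∀ i, z i = 0 ∨ z i = 1 := by
      obtain ⟨x, hx, k, rfl⟩ := hz
      exact fun i => subst_markedSubst_eq Q a x _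
    exact pairSubst_inj hne (h01 _) (h01 _) (eq_of_forall_subst_eq hcon hz hδ0 hδL)
  -- At position `Q - 3` the marked word of `a` has a `0` and the other one has a `1`.
  have := eq_of_forall_subst_eq hZ hx (r := Q - 3) (by omega) (by omega)
  unfold markedSubst markedWord at this
  refine hxa ?_
  split_ifs at this <;> omega

end Pair

/-! ### Density -/

/-- Two return times `p` and `q` of the prefix of length `N` of a point, such that the words
`x[0, p)` and `x[0, q)` do not commute and all words of length `N` occur in `x[0, q + N)`. -/
theorem Subshift.exists_return_times {X : Subshift} (hmin : X.IsMinimal) (hap : X.IsAperiodic)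
    (N : ℕ) : ∃ x ∈ X.carrier, ∃ p q : ℕ, 0 < p ∧ N ≤ q ∧
      (∀ r : ℤ, 0 ≤ r → r < N → x (p + r) = x r) ∧ (∀ r : ℤ, 0 ≤ r → r < N → x (q + r) = x r) ∧
      (∃ m : ℤ, 0 ≤ m ∧ p + m < q ∧ x m ≠ x (p + m)) ∧
      ∀ w ∈ X.lang N, ∃ s : ℤ, 0 ≤ s ∧ s < q ∧ window x s N = w := by
  obtain ⟨x, hx⟩ := hap.nonempty
  obtain ⟨M, hM⟩ := hmin.exists_recurrentWithin N
  have hreturn : ∀ b : ℕ, ∃ p : ℕ, b ≤ p ∧ ∀ r : ℤ, 0 ≤ r → r < N → x (p + r) = x r := by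
    intro b
    obtain ⟨i, hi0, -, hi⟩ := hM _ (X.shiftBy_mem b x hx) _ (window_mem_lang hx 0 N)
    rw [window_shiftBy, window_eq_iff] at hi
    refine ⟨i.toNat + b, by omega, fun r hr0 hr1 => ?_⟩
    have := hi r hr0 hr1
    rw [zero_add] at this
    rw [← this]
    congr 1; push_cast; omega
  obtain ⟨p, hp, hpr⟩ := hreturn 1
  -- Some point violates the period `p`, and by recurrence the violating word occurs in `x` to the
  -- right of `0`.
  obtain ⟨m, hm0, hm⟩ : ∃ m : ℤ, 0 ≤ m ∧ x m ≠ x (p + m) := by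
    obtain ⟨y, hy, hne⟩ := hap p (by omega)
    obtain ⟨M', hM'⟩ := hmin.exists_recurrentWithin (p + 1)
    obtain ⟨m, hm0, -, hm⟩ := hM' x hx _ (window_mem_lang hy 0 (p + 1))
    rw [window_eq_iff] at hm
    have h0 := hm 0 le_rfl (by omega)
    have h1 := hm p (by omega) (by push_cast; omega)
    rw [add_zero, add_zero] at h0
    rw [zero_add, add_comm] at h1
    exact ⟨m, hm0, by rwa [h0, h1]⟩
  -- Large enough to put the violation of the period `p` and an occurrence of each word of length
  -- `N` before `q`.
  obtain ⟨q, hq, hqr⟩ := hreturn (p + m.toNat + 1 + M + N)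
  refine ⟨x, hx, p, q, by omega, by omega, hpr, hqr, ⟨m, hm0, by omega, hm⟩, fun w hw => ?_⟩
  obtain ⟨s, hs0, hs1, hs⟩ := hM x hx w hw
  exact ⟨s, hs0, by omega, hs⟩

/-- For return times `p` and `q` of the prefix of length `N` of `x`, the concatenations of the
words `x[0, p) x[0, q)` and `x[0, q) x[0, p)` have the same words of length `N` as `X`. -/
theorem Subshift.lang_subst_pairSubst {X Z : Subshift} {N p q : ℕ} {x : ℤ → ℤ} (hx : x ∈ X.carrier)
    (hq : N ≤ q) (hpr : ∀ r : ℤ, 0 ≤ r → r < N → x (p + r) = x r)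
    (hqr : ∀ r : ℤ, 0 ≤ r → r < N → x (q + r) = x r)
    (hall : ∀ w ∈ X.lang N, ∃ s : ℤ, 0 ≤ s ∧ s < q ∧ window x s N = w) (hL : 0 < p + q)
    (hZ : ∃ z ∈ Z.carrier, z 0 = 0) :
    (Z.subst (p + q) hL (pairSubst (fun r => if r < p then x r else x (r - p))
      (fun r => if r < q then x r else x (r - q)))).lang N = X.lang N := by
  have hret : ∀ {t : ℕ}, (∀ r : ℤ, 0 ≤ r → r < N → x (t + r) = x r) → ∀ r : ℤ, r < t + N →
      (if r < t then x r else x (r - t)) = x r := by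
    intro t ht r hr
    split_ifs with h
    · rfl
    · rw [← ht (r - t) (by omega) (by omega)]
      congr 1; ring
  set c : ℤ → ℤ := fun r => if r < p then x r else x (r - p) with hc
  set d : ℤ → ℤ := fun r => if r < q then x r else x (r - q) with hd
  have hc1 : ∀ r : ℤ, r < p + N → c r = x r := hret hpr
  have hd1 : ∀ r : ℤ, r < q + N → d r = x r := hret hqr
  have hc2 : ∀ r : ℤ, p ≤ r → c r = x (r - p) := fun r hr => if_neg (by omega)
  have hd2 : ∀ r : ℤ, q ≤ r → d r = x (r - q) := fun r hr => if_neg (by omega)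
  -- The formula for a block remains valid for `N` letters past its end: both `c` and `d` begin with
  -- `x[0, N)`, and so do their continuations along `x` by the return property. As `N ≤ q`, these
  -- letters stay within the next block.
  have hblock : ∀ (z : ℤ → ℤ) (j r : ℤ), 0 ≤ r → r < p + q + N →
      StrongToeplitz.subst (p + q) (pairSubst c d) z ((p + q : ℕ) * j + r) =
        pairSubst c d (z j) r := by
    intro z j r hr0 hr1
    by_cases hr : r < (p + q : ℕ)
    · exact subst_mul_add z j hr0 hr
    · push_cast at hr
      rw [show ((p + q : ℕ) : ℤ) * j + r = (p + q : ℕ) * (j + 1) + (r - (p + q : ℕ)) by ring,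
        subst_mul_add z _ (by push_cast; omega) (by push_cast; omega)]
      have hs0 : 0 ≤ r - (p + q : ℕ) := by push_cast; omega
      have hs1 : r - (p + q : ℕ) < N := by push_cast; omega
      have e1 : ∀ b, pairSubst c d b (r - (p + q : ℕ)) = x (r - (p + q : ℕ)) := fun b => by
        unfold pairSubst
        rw [hc1 _ (by omega), hd1 _ (by omega), ite_self]
      have e2 : ∀ b, pairSubst c d b r = x (r - (p + q : ℕ)) := fun b => by
        unfold pairSubst
        rw [hc2 _ (by omega), hd2 _ (by omega)]
        rw [show r - (p : ℤ) = q + (r - (p + q : ℕ)) by push_cast; ring,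
          show r - (q : ℤ) = p + (r - (p + q : ℕ)) by push_cast; ring, hpr _ hs0 hs1,
          hqr _ hs0 hs1, ite_self]
      rw [e1, e2]
  refine Set.Subset.antisymm ?_ fun w hw => ?_
  · rintro _ ⟨_, ⟨z, -, k, rfl⟩, i, rfl⟩
    rw [window_shiftBy]
    obtain ⟨j, r, hr0, hr1, hjr⟩ := exists_eq_mul_add hL (i + k)
    rw [hjr]
    push_cast at hr1
    have hwin : ∀ s : ℤ, (∀ t : ℤ, 0 ≤ t → t < N → pairSubst c d (z j) (r + t) = x (s + t)) →
        window (StrongToeplitz.subst (p + q) (pairSubst c d) z) ((p + q : ℕ) * j + r) N ∈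
          X.lang N := by
      intro s hs
      refine ⟨x, hx, s, window_eq_iff.2 fun t ht0 ht1 => ?_⟩
      rw [← hs t ht0 ht1, add_assoc]
      exact hblock z j (r + t) (by omega) (by omega)
    by_cases hz : z j = 0
    · by_cases hr : r < p
      · refine hwin r fun t ht0 ht1 => ?_
        rw [pairSubst, if_pos hz, hc1 _ (by omega)]
      · refine hwin (r - p) fun t ht0 ht1 => ?_
        rw [pairSubst, if_pos hz, hc2 _ (by omega)]
        congr 1; ring
    · by_cases hr : r < q
      · refine hwin r fun t ht0 ht1 => ?_
        rw [pairSubst, if_neg hz, hd1 _ (by omega)]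
      · refine hwin (r - q) fun t ht0 ht1 => ?_
        rw [pairSubst, if_neg hz, hd2 _ (by omega)]
        congr 1; ring
  · obtain ⟨s, hs0, hs1, rfl⟩ := hall w hw
    obtain ⟨z, hz, hz0⟩ := hZ
    -- The factor `x[0, q)` of `c` starts at `p`, and it contains the start of an occurrence of each
    -- word of length `N`.
    refine ⟨_, ⟨z, hz, 0, rfl⟩, p + s, window_eq_iff.2 fun t ht0 ht1 => ?_⟩
    have := hblock z 0 (p + s + t) (by omega) (by omega)
    rw [mul_zero, zero_add, hz0, pairSubst, if_pos rfl, hc2 _ (by omega)] at this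
    rw [shiftBy_zero, this]
    congr 1; ring

theorem Subshift.exists_hasMarkedBlocks {X : Subshift} (hmin : X.IsMinimal) (hap : X.IsAperiodic)
    (n N : ℕ) : ∃ Y : Subshift, Y.IsMinimal ∧ Y.IsAperiodic ∧ Y.HasMarkedBlocks n ∧
      Y.lang N = X.lang N := by
  obtain ⟨a, ha⟩ := hap.exists_letter
  obtain ⟨x, hx, p, q, hp, hq, hpr, hqr, ⟨m, hm0, hmq, hm⟩, hall⟩ :=
    exists_return_times hmin hap N
  have hL : 0 < p + q := by omega
  have hQ : 0 < n + 6 := by omega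
  set c : ℤ → ℤ := fun r => if r < p then x r else x (r - p) with hc
  set d : ℤ → ℤ := fun r => if r < q then x r else x (r - q) with hd
  -- At `p + m` the word `c` shows `x m` and `d` shows `x (p + m)`.
  have hdiff : c (p + m).toNat ≠ d (p + m).toNat := by
    rw [Int.toNat_of_nonneg (by omega), hc, hd]
    dsimp only
    rwa [if_neg (by omega), if_pos hmq, add_sub_cancel_left]
  have hex : ∃ r : ℕ, c r ≠ d r := ⟨_, hdiff⟩
  classical
  have hδ := Nat.find_spec hex
  have hδlt : Nat.find hex ≤ (p + m).toNat := Nat.find_min' hex hdiff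
  have hmindiff : ∀ r : ℤ, 0 ≤ r → r < Nat.find hex → c r = d r := by
    intro r hr0 hr1
    have := Nat.find_min hex (m := r.toNat) (by omega)
    rw [Int.toNat_of_nonneg hr0] at this
    exact not_not.1 this
  refine ⟨(X.subst (n + 6) hQ (markedSubst (n + 6) a)).subst (p + q) hL (pairSubst c d),
    (hmin.subst hQ).subst hL,
    Subshift.IsAperiodic.subst_subst ha (by omega) (by omega) (by push_cast; omega) hδ,
    hasMarkedBlocks_subst_subst X n a hL (by omega) (by push_cast; omega) hδ hmindiff,
    lang_subst_pairSubst hx hq hpr hqr hall hL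
      ⟨_, ⟨x, hx, 0, rfl⟩, ?_⟩⟩
  simp [StrongToeplitz.subst, markedSubst, markedWord]

theorem dense_setOf_hasMarkedBlocks (n : ℕ) :
    Dense {X : InfiniteMinimalSubshift | X.1.HasMarkedBlocks n} := by
  rw [Metric.dense_iff]
  rintro ⟨X, hinf, hmin⟩ ε hε
  obtain ⟨N, hN⟩ := Subshift.exists_pow_lt_of_pos hε
  obtain ⟨Y, hYmin, hYap, hY, hlang⟩ := Subshift.exists_hasMarkedBlocks hmin
    (Subshift.infinite_iff_isAperiodic.1 hinf) n N
  exact ⟨⟨Y, Subshift.infinite_iff_isAperiodic.2 hYap, hYmin⟩,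
    (Subshift.dist_le_of_lang_eq hlang).trans_lt hN, hY⟩

/-! ### Genericity by the Baire category theorem -/

theorem isGeneric_isStrongToeplitz_two :
    IsGeneric {X : InfiniteMinimalSubshift | IsStrongToeplitz 2 X.1} := by
  have := polishSpace_infiniteMinimalSubshift
  have : BaireSpace InfiniteMinimalSubshift := by
    let := TopologicalSpace.upgradeIsCompletelyMetrizable InfiniteMinimalSubshift
    infer_instance
  have hopen : ∀ n : ℕ, IsOpen {X : InfiniteMinimalSubshift | X.1.HasMarkedBlocks (n + 1)} :=
    fun n => (Subshift.isOpen_setOf_hasMarkedBlocks n.succ_pos).preimage continuous_subtype_val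
  -- The index `n + 1` avoids prefix length `0`, where the block length could be `0` and the proof
  -- of openness does not apply.
  refine ⟨⋂ n : ℕ, {X : InfiniteMinimalSubshift | X.1.HasMarkedBlocks (n + 1)}, fun X hX => ?_,
    IsGδ.iInter_of_isOpen hopen, dense_iInter_of_isOpen hopen fun n =>
      dense_setOf_hasMarkedBlocks (n + 1)⟩
  rw [Set.mem_iInter] at hX
  refine isStrongToeplitz_two X.2.2 X.2.1.nonempty fun n hn => ?_
  obtain ⟨n, rfl⟩ := Nat.exists_eq_succ_of_ne_zero hn.ne'
  exact hX n

end StrongToeplitz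

theorem mainTheorem4 :
    PolishSpace StrongToeplitz.InfiniteMinimalSubshift ∧
    StrongToeplitz.IsGeneric
      {X : StrongToeplitz.InfiniteMinimalSubshift | StrongToeplitz.IsStrongToeplitz 2 X.1} ∧
    StrongToeplitz.IsGeneric
      {X : StrongToeplitz.InfiniteMinimalSubshift |
        StrongToeplitz.IsStrongToeplitzOfFiniteRank X.1} := by
  obtain ⟨t, hts, ht⟩ := StrongToeplitz.isGeneric_isStrongToeplitz_two
  exact ⟨StrongToeplitz.polishSpace_infiniteMinimalSubshift, ⟨t, hts, ht⟩,
    t, fun X hX => ⟨2, le_rfl, hts hX⟩, ht⟩
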